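/- Let $T\ge 1$, $n\ge 1$, let $u_1,\dots,u_T\in\mathbb R^n$ be non-zero, and put $\|u_{\min}\|=\min_t\|u_t\|$, $\|u_{\max}\|=\max_t\|u_t\|$. Define $S:\mathbb R^{Tn}\to\mathbb R^{Tn}$ by $(Sh)_t=\sum_{i\le t}h_i$ for $h=(h_1,\dots,h_T)$, $h_i\in\mathbb R^n$, and $O_u:\mathbb R^{Tn}\to\mathbb R^T$ by $(O_ux)_t=\langle u_t,x_t\rangle$. A random vector $X$ in $\mathbb R^m$ is called $ISG_m(\sigma,\kappa)$, $\kappa>0$, if its coordinates are independent and each coordinate satisfies $\mathbb E X_i=0$, $\mathbb E X_i^2=\sigma^2$ and $\mathbb P(|X_i|>t)\le 2e^{-t^2/\kappa^2}$ for all $t>0$. Let $Y=O_uSh+z$, where $h\sim ISG_{Tn}(\sigma,\kappa)$ and $z\sim ISG_T(\eta,\kappa)$ are independent. Let $O_uS=U\,\mathrm{Diag}(\gamma_1,\dots,\gamma_T)\,W$ be any singular value decomposition ($U$ orthogonal, $WW^*=I$, $\gamma_1\ge\dots\ge\gamma_T>0$), let $\chi_i=\gamma_{T+1-i}^{-1}$,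 let $p$ be an integer with $T/4\le p\le T$, and put $$R=W^*\mathrm{Diag}(\chi_T,\dots,\chi_1)U^*,\qquad R'=W^*\mathrm{Diag}(0,\dots,0,\chi_p,\dots,\chi_1)U^*.$$ Suppose that $\|R'\|_{HS}^2/p\ne\|R\|_{HS}^2/T$, where $\|\cdot\|_{HS}$ is the Hilbert–Schmidt norm, and define the STVE estimators $$\widehat{\eta^2}=\Big(\frac{\|R'Y\|^2}{p}-\frac{\|RY\|^2}{T}\Big)\Big/\Big(\frac{\|R'\|_{HS}^2}{p}-\frac{\|R\|_{HS}^2}{T}\Big),\qquad \widehat{\sigma^2}=\frac{\|RY\|^2}{T}-\frac{\|R\|_{HS}^2}{T}\,\widehat{\eta^2}.$$ There is an absolute constant $c>0$ such that, in all these situations and for every $0<\delta<1$, with probability at least $1-8\delta$ both $$|\widehat{\sigma^2}-\sigma^2|\le c\,\frac{(1+\kappa^2)(1+\|u_{\min}\|^{-2})\log\frac1\delta}{\sqrt T}\Big(1-\frac{p\|R\|_{HS}^2}{T\|R'\|_{HS}^2}\Big)^{-1}$$ and $$|\widehat{\eta^2}-\eta^2|\le c\,\frac{(1+\kappa^2)(1+\|u_{\min}\|^{-2})\log\frac1\delta}{\sqrt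 T}\Big(1-\frac{p\|R\|_{HS}^2}{T\|R'\|_{HS}^2}\Big)^{-1}n^2\|u_{\max}\|^2\log^2T$$ hold. -/

import Mathlib

open MeasureTheory ProbabilityTheory
open scoped Matrix

namespace STVE

noncomputable section

/-- The summation operator on sequences of `T` vectors of `ℝⁿ`: `(S h)_(t,j) = ∑_{i ≤ t} h_(i,j)`.
The space `ℝ^(Tn)` is indexed by pairs (time, coordinate). -/
def sumOp (T n : ℕ) : Matrix (Fin T × Fin n) (Fin T × Fin n) ℝ :=
  Matrix.of fun a b => if b.1 ≤ a.1 ∧ b.2 = a.2 then 1 else 0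

/-- The observation operator: `(O_u x)_t = ⟨u_t, x_t⟩`. -/
def obsOp {T n : ℕ} (u : Fin T → EuclideanSpace ℝ (Fin n)) :
    Matrix (Fin T) (Fin T × Fin n) ℝ :=
  Matrix.of fun t b => if b.1 = t then u t b.2 else 0

/-- A singular value decomposition `A = U ∘ Diag(γ₁, …, γ_T) ∘ W` of a matrix with `T` rows and
of rank `T`: `U` is orthogonal, the rows of `W` are orthonormal, `γ₁ ≥ … ≥ γ_T > 0`. -/
structure SVD {T : ℕ} {m : Type*} [Fintype m] (A : Matrix (Fin T) m ℝ) where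
  U : Matrix (Fin T) (Fin T) ℝ
  γ : Fin T → ℝ
  W : Matrix (Fin T) m ℝ
  U_orthogonal : U ∈ Matrix.orthogonalGroup (Fin T) ℝ
  W_orthonormal : W * Wᵀ = 1
  γ_antitone : Antitone γ
  γ_pos : ∀ i, 0 < γ i
  eq_mul : A = U * Matrix.diagonal γ * W

/-- The Hilbert-Schmidt (Frobenius) norm of a matrix. -/
def hsNorm {m k : Type*} [Fintype m] [Fintype k] (A : Matrix m k ℝ) : ℝ :=
  @norm _ Matrix.frobeniusNormedAddCommGroup.toNorm A

/-- The Euclidean norm of a vector. -/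
def euclNorm {m : Type*} [Fintype m] (v : m → ℝ) : ℝ := ‖WithLp.toLp 2 v‖

namespace SVD

variable {T : ℕ} {m : Type*} [Fintype m] {A : Matrix (Fin T) m ℝ}

/-- The numbers `χ₁ ≥ … ≥ χ_T`, where `χ_i` is the inverse of `γ_(T+1-i)`. -/
def χ (D : SVD A) (i : Fin T) : ℝ := (D.γ (Fin.rev i))⁻¹

/-- `R = W* ∘ Diag(χ_T, …, χ₁) ∘ U*`. -/
def R (D : SVD A) : Matrix m (Fin T) ℝ :=
  D.Wᵀ * Matrix.diagonal (fun i => D.χ (Fin.rev i)) * D.Uᵀ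

/-- `R' = W* ∘ Diag(0, …, 0, χ_p, …, χ₁) ∘ U*`. -/
def R' (D : SVD A) (p : ℕ) : Matrix m (Fin T) ℝ :=
  D.Wᵀ * Matrix.diagonal (fun i => if (Fin.rev i : ℕ) < p then D.χ (Fin.rev i) else 0) * D.Uᵀ

/-- The estimator of `η²` computed from the observations `Y`. -/
def etaSqHat (D : SVD A) (p : ℕ) (Y : Fin T → ℝ) : ℝ :=
  (euclNorm (D.R' p *ᵥ Y) ^ 2 / p - euclNorm (D.R *ᵥ Y) ^ 2 / T) /
    (hsNorm (D.R' p) ^ 2 / p - hsNorm D.R ^ 2 / T)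

/-- The estimator of `σ²` computed from the observations `Y`. -/
def sigmaSqHat (D : SVD A) (p : ℕ) (Y : Fin T → ℝ) : ℝ :=
  euclNorm (D.R *ᵥ Y) ^ 2 / T - hsNorm D.R ^ 2 / T * D.etaSqHat p Y

end SVD

/-- A centered random variable that is sub-Gaussian with constant `κ` (used for `κ > 0`). -/
structure IsSG {Ω : Type*} [MeasurableSpace Ω] (μ : Measure Ω) (X : Ω → ℝ) (κ : ℝ) : Prop where
  measurable : Measurable X
  mean_zero : ∫ ω, X ω ∂μ = 0
  tail : ∀ t : ℝ, 0 < t → μ.real {ω | t < |X ω|} ≤ 2 * Real.exp (-(t ^ 2 / κ ^ 2))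

/-- A random vector that is `σ`-isotropically `κ` sub-Gaussian with independent components. -/
structure IsISG {Ω : Type*} [MeasurableSpace Ω] (μ : Measure Ω) {ι : Type*}
    (X : Ω → ι → ℝ) (σ κ : ℝ) : Prop where
  indep : iIndepFun (fun i ω => X ω i) μ
  sq_mean : ∀ i, ∫ ω, X ω i ^ 2 ∂μ = σ ^ 2
  subGaussian : ∀ i, IsSG μ (fun ω => X ω i) κ

end

end STVE

/-! Write `A` for the observed summation operator. Both `R` and `R'` have the form W* Diag(q_i/γ_i)
U* with a 0/1 filter q. Since W* is an isometry and U*A = Diag(γ)W, the energy of the filtered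
observation is the quadratic form of BᵀB in the single independent vector (h, z), where row i of B
is q_i(W_i, γ_i⁻¹U_i). These rows are orthogonal with squared length q_i²(1 + γ_i⁻²). Hence the
energy has mean σ²∑q_i² + η²‖·‖_HS², and BᵀB has Hilbert–Schmidt norm at most √T(1 + max γ_i⁻²).

Concentration only needs a Hanson–Wright bound in the Hilbert–Schmidt norm
(`measure_quadraticForm_le`). It comes from exponential moments: the diagonal part factorizes by
independence, and the off-diagonal part is an average over cuts of bilinear forms in two independent
blocks. Convexity of exp recombines the pieces.

Two spectral facts enter. Differencing inverts summation and has norm at most 2, so γ_i⁻¹ ≤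
2/‖u_min‖ (`inv_γ_sq_le`). Conversely, at least half of the γ_i are at most 2n‖u_max‖
(`two_mul_card_large_γ_le`), so ‖R‖_HS²/T ≥ 1/(8n²‖u_max‖²), with no logarithm.

The estimators solve the 2×2 linear system given by the normalized means σ² + η²r and σ² + η²r',
with r < r', so the energy errors propagate with the factor (1 - r/r')⁻¹ (`abs_estimator_sub_le`).
-/

namespace STVE

/-! ### Exponential moments of one sub-Gaussian variable. -/

section OneDim

variable {Ω : Type*} [MeasurableSpace Ω] {μ : Measure Ω} [IsProbabilityMeasure μ]

/-- Layer-cake formula for X²: the density (a/2)exp(as/2) against the tail 2exp(-as) integrates to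
2, and the total mass adds 1. Stating moments as `∫⁻` bounds lets later steps use Tonelli without
integrability conditions. -/
lemma lintegral_exp_sq_le_of_tail {X : Ω → ℝ} {a : ℝ} (ha : 0 < a) (hX : Measurable X)
    (htail : ∀ t : ℝ, 0 < t → μ.real {ω | t < |X ω|} ≤ 2 * Real.exp (-(a * t ^ 2))) :
    ∫⁻ ω, ENNReal.ofReal (Real.exp (a / 2 * X ω ^ 2)) ∂μ ≤ 3 := by
  have hprim : ∀ x : ℝ, ∫ t in (0 : ℝ)..x, a / 2 * Real.exp (a / 2 * t)
      = Real.exp (a / 2 * x) - 1 := by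
    intro x
    rw [intervalIntegral.integral_eq_sub_of_hasDerivAt (f := fun t => Real.exp (a / 2 * t))]
    · simp
    · intro t _
      have := ((hasDerivAt_id t).const_mul (a / 2)).exp
      simpa [mul_comm] using this
    · exact (by fun_prop : Continuous fun t => a / 2 * Real.exp (a / 2 * t)).intervalIntegrable _ _
  have h1 := lintegral_comp_eq_lintegral_meas_lt_mul μ (f := fun ω => X ω ^ 2)
    (g := fun t => a / 2 * Real.exp (a / 2 * t))
    (Filter.Eventually.of_forall fun ω => sq_nonneg _) (by fun_prop)
    (fun t _ => (by fun_prop : Continuous fun t =>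
      a / 2 * Real.exp (a / 2 * t)).intervalIntegrable _ _)
    (Filter.Eventually.of_forall fun t => by positivity)
  simp_rw [hprim] at h1
  have h2 : ∀ ω, ENNReal.ofReal (Real.exp (a / 2 * X ω ^ 2))
      = 1 + ENNReal.ofReal (Real.exp (a / 2 * X ω ^ 2) - 1) := by
    intro ω
    rw [← ENNReal.ofReal_one, ← ENNReal.ofReal_add (by simp)]
    · simp
    · rw [sub_nonneg]; exact Real.one_le_exp (by positivity)
  simp_rw [h2]
  rw [lintegral_add_left measurable_const, h1]
  have h3 : ∫⁻ t in Set.Ioi (0 : ℝ), μ {ω | t < X ω ^ 2} *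
      ENNReal.ofReal (a / 2 * Real.exp (a / 2 * t)) ≤
      ∫⁻ t in Set.Ioi (0 : ℝ), ENNReal.ofReal (a * Real.exp (-(a / 2) * t)) := by
    refine setLIntegral_mono' measurableSet_Ioi fun t ht => ?_
    have ht' : (0 : ℝ) < t := ht
    have hset : {ω | t < X ω ^ 2} = {ω | √t < |X ω|} := by
      ext ω
      change t < X ω ^ 2 ↔ √t < |X ω|
      rw [← sq_abs, Real.sqrt_lt ht'.le (abs_nonneg _)]
    have := htail (√t) (Real.sqrt_pos.2 ht')
    rw [Real.sq_sqrt ht'.le] at this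
    rw [hset, ← ofReal_measureReal, ← ENNReal.ofReal_mul (by positivity)]
    refine ENNReal.ofReal_le_ofReal ?_
    calc _ ≤ 2 * Real.exp (-(a * t)) * (a / 2 * Real.exp (a / 2 * t)) := by gcongr
      _ = a * (Real.exp (-(a * t)) * Real.exp (a / 2 * t)) := by ring
      _ = _ := by rw [← Real.exp_add]; ring_nf
  have h4 : ∫⁻ t in Set.Ioi (0 : ℝ), ENNReal.ofReal (a * Real.exp (-(a / 2) * t)) = 2 := by
    rw [← ofReal_integral_eq_lintegral_ofReal]
    · rw [integral_const_mul, integral_exp_mul_Ioi (by linarith)]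
      rw [show a * (-Real.exp (-(a / 2) * 0) / -(a / 2)) = 2 by simp; field_simp]
      simp
    · exact (integrableOn_exp_mul_Ioi (by linarith) 0).const_mul a
    · exact Filter.Eventually.of_forall fun t => by positivity
  calc _ ≤ 1 + (2 : ENNReal) := by
        gcongr
        · simp
        · exact h3.trans h4.le
    _ = 3 := by norm_num

/-- The linear term disappears in expectation for a centered variable, leaving only the exponential
of the square. -/
lemma exp_le_add_exp_sq (x : ℝ) : Real.exp x ≤ x + Real.exp (x ^ 2) := by
  have h := Real.add_one_le_exp (x ^ 2)
  rcases le_total |x| 1 with h1 | h1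
  · have := (abs_le.1 (Real.abs_exp_sub_one_sub_id_le h1)).2
    linarith
  · rcases le_total 0 x with hx | hx
    · rw [abs_of_nonneg hx] at h1
      have : Real.exp x ≤ Real.exp (x ^ 2) := Real.exp_le_exp.2 (by nlinarith)
      linarith
    · rw [abs_of_nonpos hx] at h1
      have : Real.exp x ≤ 1 := Real.exp_le_one_iff.2 hx
      nlinarith

lemma exp_le_one_add_sq_mul_exp_abs (x : ℝ) :
    Real.exp x ≤ 1 + x + x ^ 2 * Real.exp |x| := by
  rcases le_total |x| 1 with h1 | h1
  · have := (abs_le.1 (Real.abs_exp_sub_one_sub_id_le h1)).2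
    have h2 : x ^ 2 * 1 ≤ x ^ 2 * Real.exp |x| := by gcongr; exact Real.one_le_exp (abs_nonneg _)
    linarith
  · rcases le_total 0 x with hx | hx
    · rw [abs_of_nonneg hx] at h1 ⊢
      have : 1 * Real.exp x ≤ x ^ 2 * Real.exp x := by gcongr; nlinarith
      linarith
    · have h2 : x ^ 2 * 1 ≤ x ^ 2 * Real.exp |x| := by
        gcongr; exact Real.one_le_exp (abs_nonneg _)
      rw [abs_of_nonpos hx] at h1 h2 ⊢
      have : Real.exp x ≤ 1 := Real.exp_le_one_iff.2 hx
      nlinarith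

/-- Convexity of the exponential on `[0, y]`. -/
lemma exp_mul_le_of_mem_Icc {θ : ℝ} (h0 : 0 ≤ θ) (h1 : θ ≤ 1) (y : ℝ) :
    Real.exp (θ * y) ≤ 1 + θ * (Real.exp y - 1) := by
  have := convexOn_exp.2 (Set.mem_univ y) (Set.mem_univ 0) h0 (sub_nonneg.2 h1) (by ring)
  simp only [smul_eq_mul, mul_zero, add_zero, Real.exp_zero, mul_one] at this
  linarith

variable {X : Ω → ℝ} {a : ℝ}

omit [IsProbabilityMeasure μ] in
lemma integrable_exp_sq (hX : Measurable X)
    (h : ∫⁻ ω, ENNReal.ofReal (Real.exp (a / 2 * X ω ^ 2)) ∂μ ≤ 3) :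
    Integrable (fun ω => Real.exp (a / 2 * X ω ^ 2)) μ := by
  refine ⟨by fun_prop, ?_⟩
  rw [hasFiniteIntegral_iff_ofReal (Filter.Eventually.of_forall fun _ => (Real.exp_pos _).le)]
  exact h.trans_lt (by simp)

omit [IsProbabilityMeasure μ] in
lemma integral_exp_sq_le (hX : Measurable X)
    (h : ∫⁻ ω, ENNReal.ofReal (Real.exp (a / 2 * X ω ^ 2)) ∂μ ≤ 3) :
    ∫ ω, Real.exp (a / 2 * X ω ^ 2) ∂μ ≤ 3 := by
  rw [integral_eq_lintegral_of_nonneg_ae (Filter.Eventually.of_forall fun _ => (Real.exp_pos _).le)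
    (by fun_prop)]
  exact ENNReal.toReal_le_of_le_ofReal (by norm_num) (by simpa using h)

omit [IsProbabilityMeasure μ] in
lemma integrable_sq_of_exp_sq (ha : 0 < a) (hX : Measurable X)
    (h : ∫⁻ ω, ENNReal.ofReal (Real.exp (a / 2 * X ω ^ 2)) ∂μ ≤ 3) :
    Integrable (fun ω => X ω ^ 2) μ := by
  refine ((integrable_exp_sq hX h).const_mul (2 / a)).mono' (by fun_prop) ?_
  refine Filter.Eventually.of_forall fun ω => ?_
  rw [Real.norm_of_nonneg (sq_nonneg _)]
  have := Real.add_one_le_exp (a / 2 * X ω ^ 2)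
  calc X ω ^ 2 = 2 / a * (a / 2 * X ω ^ 2) := by field_simp
    _ ≤ _ := by gcongr; linarith

lemma integrable_of_exp_sq (ha : 0 < a) (hX : Measurable X)
    (h : ∫⁻ ω, ENNReal.ofReal (Real.exp (a / 2 * X ω ^ 2)) ∂μ ≤ 3) :
    Integrable X μ := by
  refine ((integrable_sq_of_exp_sq ha hX h).add (integrable_const 1)).mono' (by fun_prop) ?_
  refine Filter.Eventually.of_forall fun ω => ?_
  simp only [Real.norm_eq_abs, Pi.add_apply]
  nlinarith [sq_abs (X ω), sq_nonneg (|X ω| - 1), abs_nonneg (X ω)]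

/-- Put θ = 2t²/a; the target is exp(2θ). For θ ≤ 1, centering reduces exp(tX) to exp(t²X²) =
exp(θ·aX²/2), and convexity in θ gives 1 + θ(3 - 1). For θ ≥ 1, Young's inequality tX ≤ t²/(2a) +
aX²/2 suffices. -/
lemma hasSubgaussianMGF_of_exp_sq (ha : 0 < a) (hX : Measurable X) (hmean : ∫ ω, X ω ∂μ = 0)
    (h : ∫⁻ ω, ENNReal.ofReal (Real.exp (a / 2 * X ω ^ 2)) ∂μ ≤ 3) :
    HasSubgaussianMGF X (8 / a).toNNReal μ := by
  have hint := integrable_exp_sq hX h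
  have h3 := integral_exp_sq_le hX h
  have hyoung : ∀ t ω, Real.exp (t * X ω) ≤
      Real.exp (t ^ 2 / (2 * a)) * Real.exp (a / 2 * X ω ^ 2) := by
    intro t ω
    rw [← Real.exp_add]
    refine Real.exp_le_exp.2 ?_
    have : t ^ 2 / (2 * a) + a / 2 * X ω ^ 2 - t * X ω = (t - a * X ω) ^ 2 / (2 * a) := by
      field_simp; ring
    have : 0 ≤ (t - a * X ω) ^ 2 / (2 * a) := by positivity
    linarith
  have hintt : ∀ t, Integrable (fun ω => Real.exp (t * X ω)) μ := by
    intro t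
    refine (hint.const_mul (Real.exp (t ^ 2 / (2 * a)))).mono' (by fun_prop) ?_
    refine Filter.Eventually.of_forall fun ω => ?_
    rw [Real.norm_of_nonneg (Real.exp_pos _).le]
    exact hyoung t ω
  refine ⟨hintt, fun t => ?_⟩
  rw [Real.coe_toNNReal _ (by positivity)]
  have htarget : 8 / a * t ^ 2 / 2 = 2 * (2 * t ^ 2 / a) := by ring
  rw [htarget, mgf]
  rcases le_total (2 * t ^ 2 / a) 1 with ht | ht
  · have hpt : ∀ ω, Real.exp (t * X ω) ≤
        t * X ω + (1 + 2 * t ^ 2 / a * (Real.exp (a / 2 * X ω ^ 2) - 1)) := by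
      intro ω
      refine (exp_le_add_exp_sq _).trans ?_
      gcongr
      have := exp_mul_le_of_mem_Icc (by positivity) ht (a / 2 * X ω ^ 2)
      rwa [show 2 * t ^ 2 / a * (a / 2 * X ω ^ 2) = (t * X ω) ^ 2 by field_simp] at this
    have hX1 := (integrable_of_exp_sq ha hX h).const_mul t
    have hX2 : Integrable (fun ω => 2 * t ^ 2 / a * (Real.exp (a / 2 * X ω ^ 2) - 1)) μ :=
      (hint.sub (integrable_const 1)).const_mul (2 * t ^ 2 / a)
    have hX3 : Integrable (fun ω => 1 + 2 * t ^ 2 / a * (Real.exp (a / 2 * X ω ^ 2) - 1)) μ :=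
      (integrable_const 1).add hX2
    calc ∫ ω, Real.exp (t * X ω) ∂μ
        ≤ ∫ ω, (t * X ω + (1 + 2 * t ^ 2 / a * (Real.exp (a / 2 * X ω ^ 2) - 1))) ∂μ :=
          integral_mono (hintt t) (hX1.add hX3) hpt
      _ = 1 + 2 * t ^ 2 / a * (∫ ω, Real.exp (a / 2 * X ω ^ 2) ∂μ - 1) := by
          rw [integral_add hX1 hX3, integral_const_mul, hmean,
            integral_add (integrable_const 1) hX2, integral_const_mul,
            integral_sub hint (integrable_const 1)]
          simp
      _ ≤ 1 + 2 * t ^ 2 / a * (3 - 1) := by gcongr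
      _ ≤ _ := by
          have := Real.add_one_le_exp (2 * (2 * t ^ 2 / a))
          linarith
  · calc ∫ ω, Real.exp (t * X ω) ∂μ
        ≤ ∫ ω, Real.exp (t ^ 2 / (2 * a)) * Real.exp (a / 2 * X ω ^ 2) ∂μ :=
          integral_mono (hintt t) (hint.const_mul _) (hyoung t)
      _ = Real.exp (t ^ 2 / (2 * a)) * ∫ ω, Real.exp (a / 2 * X ω ^ 2) ∂μ := integral_const_mul _ _
      -- The first factor is exp(θ/4), so 7θ/4 of the exponent 2θ remains to absorb the 3.
      _ ≤ Real.exp (t ^ 2 / (2 * a)) * Real.exp (7 / 4 * (2 * t ^ 2 / a)) := by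
          gcongr
          refine h3.trans ?_
          calc (3 : ℝ) ≤ 1 + 7 / 4 + (7 / 4) ^ 2 / 2 := by norm_num
            _ ≤ Real.exp (7 / 4) := Real.quadratic_le_exp_of_nonneg (by norm_num)
            _ ≤ _ := Real.exp_le_exp.2 (by linarith)
      _ = _ := by rw [← Real.exp_add]; congr 1; field_simp; ring

/-- Chernoff on both sides gives the tail 2exp(-t²/(2v)), which feeds the layer-cake bound with a =
1/(2v). The positive majorant `v` allows the proxy `c` to vanish, as it does for a zero linear form.
-/
lemma lintegral_exp_mul_sq_le_of_hasSubgaussianMGF {Z : Ω → ℝ} {c : NNReal} {v s : ℝ}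
    (hZ : HasSubgaussianMGF Z c μ) (hZm : Measurable Z) (hv : 0 < v) (hc : c ≤ v)
    (hs : 4 * v * s ≤ 1) :
    ∫⁻ ω, ENNReal.ofReal (Real.exp (s * Z ω ^ 2)) ∂μ ≤ 3 := by
  have hc' : HasSubgaussianMGF Z v.toNNReal μ :=
    ⟨hZ.integrable_exp_mul, fun t => (hZ.mgf_le t).trans <| Real.exp_le_exp.2 <| by
      rw [Real.coe_toNNReal _ hv.le]; gcongr⟩
  have key : ∫⁻ ω, ENNReal.ofReal (Real.exp (1 / (2 * v) / 2 * Z ω ^ 2)) ∂μ ≤ 3 := by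
    refine lintegral_exp_sq_le_of_tail (by positivity) hZm fun t ht => ?_
    have h1 := hc'.measure_ge_le ht.le
    have h2 := hc'.neg.measure_ge_le ht.le
    rw [Real.coe_toNNReal _ hv.le] at h1 h2
    have hsub : {ω | t < |Z ω|} ⊆ {ω | t ≤ Z ω} ∪ {ω | t ≤ (-Z) ω} := by
      intro ω hω
      rcases lt_abs.1 (show t < |Z ω| from hω) with h | h
      · exact Or.inl h.le
      · exact Or.inr h.le
    calc μ.real {ω | t < |Z ω|} ≤ _ := measureReal_mono hsub
      _ ≤ _ := measureReal_union_le _ _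
      _ ≤ _ := add_le_add h1 h2
      _ = _ := by rw [← two_mul]; congr 3; field_simp
  refine (lintegral_mono fun ω => ENNReal.ofReal_le_ofReal (Real.exp_le_exp.2 ?_)).trans key
  gcongr
  rw [div_div, le_div_iff₀ (by positivity)]
  linarith

/-- Second-order expansion with Z = X² - m: the linear term integrates to zero. The threshold a/4 is
chosen so that Z² and exp|sZ| each cost a factor exp(a|Z|/4), together the available moment of order
a/2. The factor 768 is 16·2·8·3, with 8 bounding exp(am/2) ≤ e². -/
lemma lintegral_exp_mul_sq_sub_le (ha : 0 < a) (hX : Measurable X) {m s : ℝ}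
    (hm : ∫ ω, X ω ^ 2 ∂μ = m) (hs : |s| ≤ a / 4)
    (h : ∫⁻ ω, ENNReal.ofReal (Real.exp (a / 2 * X ω ^ 2)) ∂μ ≤ 3) :
    ∫⁻ ω, ENNReal.ofReal (Real.exp (s * (X ω ^ 2 - m))) ∂μ ≤
      ENNReal.ofReal (Real.exp (768 * s ^ 2 / a ^ 2)) := by
  have hint := integrable_exp_sq hX h
  have h3 := integral_exp_sq_le hX h
  have hsq := integrable_sq_of_exp_sq ha hX h
  have hm0 : 0 ≤ m := hm ▸ integral_nonneg fun ω => sq_nonneg _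
  have hm2 : a / 2 * m ≤ 2 := by
    have : ∫ ω, (a / 2 * X ω ^ 2 + 1) ∂μ ≤ ∫ ω, Real.exp (a / 2 * X ω ^ 2) ∂μ :=
      integral_mono ((hsq.const_mul _).add (integrable_const _)) hint
        fun ω => Real.add_one_le_exp _
    rw [integral_add (hsq.const_mul _) (integrable_const _), integral_const_mul, hm] at this
    simp at this
    linarith
  have hem : Real.exp (a / 2 * m) ≤ 8 := by
    have := Real.exp_one_lt_d9
    calc Real.exp (a / 2 * m) ≤ Real.exp 2 := Real.exp_le_exp.2 hm2
      _ = Real.exp 1 * Real.exp 1 := by rw [← Real.exp_add]; norm_num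
      _ ≤ 8 := by nlinarith [Real.exp_pos 1]
  have hpt : ∀ ω, Real.exp (s * (X ω ^ 2 - m)) ≤
      1 + s * (X ω ^ 2 - m) + 256 * s ^ 2 / a ^ 2 * Real.exp (a / 2 * X ω ^ 2) := by
    intro ω
    refine (exp_le_one_add_sq_mul_exp_abs _).trans ?_
    gcongr 1 + s * (X ω ^ 2 - m) + ?_
    set Z := X ω ^ 2 - m with hZ
    have hZabs : |Z| ≤ X ω ^ 2 + m := by
      rw [abs_le]; constructor <;> nlinarith [sq_nonneg (X ω)]
    have h1 : |s * Z| ≤ a / 4 * |Z| := by rw [abs_mul]; gcongr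
    have h2 : (a / 4 * |Z|) ^ 2 ≤ 2 * Real.exp (a / 4 * |Z|) := by
      have := Real.quadratic_le_exp_of_nonneg (x := a / 4 * |Z|) (by positivity)
      have : 0 ≤ a / 4 * |Z| := by positivity
      linarith
    calc (s * Z) ^ 2 * Real.exp |s * Z|
        = 16 * s ^ 2 / a ^ 2 * (a / 4 * |Z|) ^ 2 * Real.exp |s * Z| := by
          rw [mul_pow, mul_pow, sq_abs]; field_simp; ring
      _ ≤ 16 * s ^ 2 / a ^ 2 * (2 * Real.exp (a / 4 * |Z|)) * Real.exp (a / 4 * |Z|) := by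
          gcongr
      _ = 32 * s ^ 2 / a ^ 2 * (Real.exp (a / 4 * |Z|) * Real.exp (a / 4 * |Z|)) := by ring
      _ = 32 * s ^ 2 / a ^ 2 * Real.exp (a / 2 * |Z|) := by rw [← Real.exp_add]; ring_nf
      _ ≤ 32 * s ^ 2 / a ^ 2 * Real.exp (a / 2 * (X ω ^ 2 + m)) := by gcongr
      _ = 32 * s ^ 2 / a ^ 2 * (Real.exp (a / 2 * X ω ^ 2) * Real.exp (a / 2 * m)) := by
          rw [← Real.exp_add]; ring_nf
      _ ≤ 32 * s ^ 2 / a ^ 2 * (Real.exp (a / 2 * X ω ^ 2) * 8) := by gcongr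
      _ = _ := by ring
  have hlin : Integrable (fun ω => s * (X ω ^ 2 - m)) μ :=
    (hsq.sub (integrable_const m)).const_mul s
  have hrhs1 : Integrable (fun ω => 1 + s * (X ω ^ 2 - m)) μ := (integrable_const 1).add hlin
  have hrhs2 := hint.const_mul (256 * s ^ 2 / a ^ 2)
  calc ∫⁻ ω, ENNReal.ofReal (Real.exp (s * (X ω ^ 2 - m))) ∂μ
      ≤ ∫⁻ ω, ENNReal.ofReal
          (1 + s * (X ω ^ 2 - m) + 256 * s ^ 2 / a ^ 2 * Real.exp (a / 2 * X ω ^ 2)) ∂μ :=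
        lintegral_mono fun ω => ENNReal.ofReal_le_ofReal (hpt ω)
    _ = ENNReal.ofReal (∫ ω, (1 + s * (X ω ^ 2 - m) +
          256 * s ^ 2 / a ^ 2 * Real.exp (a / 2 * X ω ^ 2)) ∂μ) := by
        refine (ofReal_integral_eq_lintegral_ofReal (hrhs1.add hrhs2) ?_).symm
        exact Filter.Eventually.of_forall fun ω => (Real.exp_pos _).le.trans (hpt ω)
    _ ≤ _ := by
        refine ENNReal.ofReal_le_ofReal ?_
        rw [integral_add hrhs1 hrhs2, integral_add (integrable_const 1) hlin, integral_const_mul,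
          integral_const_mul, integral_sub hsq (integrable_const m), hm]
        simp only [integral_const, probReal_univ, smul_eq_mul, mul_one, one_mul, sub_self,
          mul_zero, add_zero]
        have := Real.add_one_le_exp (768 * s ^ 2 / a ^ 2)
        have h5 : 256 * s ^ 2 / a ^ 2 * ∫ ω, Real.exp (a / 2 * X ω ^ 2) ∂μ
          ≤ 256 * s ^ 2 / a ^ 2 * 3 := by gcongr
        have h6 : 256 * s ^ 2 / a ^ 2 * 3 = 768 * s ^ 2 / a ^ 2 := by ring
        linarith

end OneDim

/-! ### Decoupling by averaging over cuts. -/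

section Decoupling

variable {ι : Type*} [Fintype ι] [DecidableEq ι]

/-- Symmetric difference with ∅, {i}, {j}, {i, j} permutes the subsets, and for each E exactly one
of the four resulting sets contains i and misses j. -/
lemma sum_ite_mem_notMem_powerset (i j : ι) (hij : i ≠ j) :
    4 * ∑ E : Finset ι, (if i ∈ E ∧ j ∉ E then (1 : ℝ) else 0) = Fintype.card (Finset ι) := by
  have hflip : ∀ A : Finset ι, ∑ E : Finset ι, (if i ∈ E ∧ j ∉ E then (1 : ℝ) else 0) =
      ∑ E : Finset ι, (if i ∈ symmDiff E A ∧ j ∉ symmDiff E A then (1 : ℝ) else 0) := fun A =>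
    (Equiv.sum_comp (symmDiff_left_involutive A).toPerm
      fun E => if i ∈ E ∧ j ∉ E then (1 : ℝ) else 0).symm
  calc _ = ∑ E : Finset ι, ((if i ∈ E ∧ j ∉ E then (1 : ℝ) else 0) +
        (if i ∈ symmDiff E {i} ∧ j ∉ symmDiff E {i} then (1 : ℝ) else 0) +
        (if i ∈ symmDiff E {j} ∧ j ∉ symmDiff E {j} then (1 : ℝ) else 0) +
        (if i ∈ symmDiff E {i, j} ∧ j ∉ symmDiff E {i, j} then (1 : ℝ) else 0)) := by
        simp_rw [Finset.sum_add_distrib]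
        rw [← hflip, ← hflip, ← hflip]
        ring
    _ = ∑ E : Finset ι, (1 : ℝ) := by
        refine Finset.sum_congr rfl fun E _ => ?_
        by_cases hi : i ∈ E <;> by_cases hj : j ∈ E <;>
          simp [Finset.mem_symmDiff, hi, hj, hij, hij.symm]
    _ = _ := by simp

/-- Averaging the off-diagonal part of a quadratic form over all cuts of the index set. -/
lemma four_mul_sum_cuts (M : ι → ι → ℝ) :
    4 * ∑ E : Finset ι, ∑ i ∈ E, ∑ j ∈ Eᶜ, M i j =
      Fintype.card (Finset ι) * ∑ i, ∑ j, (if i = j then 0 else M i j) := by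
  have h : ∀ E : Finset ι, ∑ i ∈ E, ∑ j ∈ Eᶜ, M i j =
      ∑ i, ∑ j, (if i ∈ E ∧ j ∉ E then (1 : ℝ) else 0) * M i j := by
    intro E
    rw [← Finset.sum_subset (Finset.subset_univ E)]
    · refine Finset.sum_congr rfl fun i hi => ?_
      rw [← Finset.sum_subset (Finset.subset_univ Eᶜ)]
      · exact Finset.sum_congr rfl fun j hj => by simp [hi, Finset.mem_compl.1 hj]
      · intro j _ hj; simp at hj; simp [hj]
    · intro i _ hi; simp [hi]
  simp_rw [h]
  rw [Finset.sum_comm, Finset.mul_sum, Finset.mul_sum]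
  refine Finset.sum_congr rfl fun i _ => ?_
  rw [Finset.sum_comm, Finset.mul_sum, Finset.mul_sum]
  refine Finset.sum_congr rfl fun j _ => ?_
  rw [← Finset.sum_mul, ← mul_assoc]
  split_ifs with hij
  · subst hij; simp
  · rw [sum_ite_mem_notMem_powerset i j hij]

end Decoupling

/-! ### Conditioning and convexity of exponential moments. -/

section Independence

variable {Ω : Type*} [MeasurableSpace Ω] {μ : Measure Ω} [IsProbabilityMeasure μ]

/-- Tonelli on the product law: a bound valid for each frozen value of `Y` may be integrated over
`Y`. -/
lemma lintegral_comp_le_of_indepFun {α β : Type*} [MeasurableSpace α] [MeasurableSpace β]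
    {X : Ω → α} {Y : Ω → β} (hX : Measurable X) (hY : Measurable Y) (h : IndepFun X Y μ)
    {F : α → β → ENNReal} (hF : Measurable (Function.uncurry F)) {G : β → ENNReal}
    (hFG : ∀ y, ∫⁻ ω, F (X ω) y ∂μ ≤ G y) :
    ∫⁻ ω, F (X ω) (Y ω) ∂μ ≤ ∫⁻ ω, G (Y ω) ∂μ := by
  have h1 : ∫⁻ ω, F (X ω) (Y ω) ∂μ = ∫⁻ p, Function.uncurry F p ∂(μ.map fun ω => (X ω, Y ω)) := by
    rw [lintegral_map hF (hX.prodMk hY)]; rfl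
  rw [h1, (indepFun_iff_map_prod_eq_prod_map_map hX.aemeasurable hY.aemeasurable).1 h,
    lintegral_prod_symm' _ hF, lintegral_map (by fun_prop) hY]
  refine lintegral_mono fun ω => ?_
  rw [lintegral_map (by fun_prop) hX]
  exact hFG (Y ω)

/-- Exponential moment of a weighted sum, by convexity. -/
lemma lintegral_exp_sum_le {κ : Type*} {s : Finset κ} {w : κ → ℝ} {Z : κ → Ω → ℝ} {C : ENNReal}
    (hw : ∀ i ∈ s, 0 ≤ w i) (hw1 : ∑ i ∈ s, w i ≤ 1) (hZ : ∀ i, Measurable (Z i)) (hC : 1 ≤ C)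
    (h : ∀ i ∈ s, ∫⁻ ω, ENNReal.ofReal (Real.exp (Z i ω)) ∂μ ≤ C) :
    ∫⁻ ω, ENNReal.ofReal (Real.exp (∑ i ∈ s, w i * Z i ω)) ∂μ ≤ C := by
  have hpt : ∀ ω, ENNReal.ofReal (Real.exp (∑ i ∈ s, w i * Z i ω)) ≤
      ENNReal.ofReal (1 - ∑ i ∈ s, w i) +
        ∑ i ∈ s, ENNReal.ofReal (w i) * ENNReal.ofReal (Real.exp (Z i ω)) := by
    intro ω
    simp_rw [← ENNReal.ofReal_mul' (Real.exp_pos _).le]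
    rw [← ENNReal.ofReal_sum_of_nonneg fun i hi => mul_nonneg (hw i hi) (Real.exp_pos _).le,
      ← ENNReal.ofReal_add (by linarith)
        (Finset.sum_nonneg fun i hi => mul_nonneg (hw i hi) (Real.exp_pos _).le)]
    refine ENNReal.ofReal_le_ofReal ?_
    -- The missing weight 1 - ∑w is placed at the point 0, where exp equals 1 ≤ C.
    have := convexOn_exp.map_add_sum_le (t := s) (w := w) (p := fun i => Z i ω)
      (v := 1 - ∑ i ∈ s, w i) (q := 0) hw (by ring) (fun _ _ => Set.mem_univ _) (by linarith)
      (Set.mem_univ _)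
    simpa using this
  calc _ ≤ _ := lintegral_mono hpt
    _ = ENNReal.ofReal (1 - ∑ i ∈ s, w i) +
        ∑ i ∈ s, ENNReal.ofReal (w i) * ∫⁻ ω, ENNReal.ofReal (Real.exp (Z i ω)) ∂μ := by
      rw [lintegral_add_left measurable_const, lintegral_finsetSum]
      · simp only [lintegral_const, measure_univ, mul_one]
        congr 1
        refine Finset.sum_congr rfl fun i _ => ?_
        rw [lintegral_const_mul]
        have := hZ i
        fun_prop
      · intro i _
        have := hZ i
        fun_prop
    _ ≤ ENNReal.ofReal (1 - ∑ i ∈ s, w i) * C + ∑ i ∈ s, ENNReal.ofReal (w i) * C := by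
      gcongr with i hi
      · exact le_mul_of_one_le_right' hC
      · exact h i hi
    _ = C := by
      rw [← Finset.sum_mul, ← add_mul, ← ENNReal.ofReal_sum_of_nonneg hw,
        ← ENNReal.ofReal_add (by linarith) (Finset.sum_nonneg hw)]
      simp

/-! ### Linear and quadratic forms in independent sub-Gaussian variables. -/

variable {ι : Type*} [Fintype ι] [DecidableEq ι] {ξ : ι → Ω → ℝ} {a : ℝ}

omit [IsProbabilityMeasure μ] [Fintype ι] [DecidableEq ι] in
lemma hasSubgaussianMGF_linear (hind : iIndepFun ξ μ) {c : NNReal}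
    (hξ : ∀ i, HasSubgaussianMGF (ξ i) c μ) (s : Finset ι) (v : ι → ℝ) :
    HasSubgaussianMGF (fun ω => ∑ i ∈ s, v i * ξ i ω)
      (∑ i ∈ s, (v i ^ 2).toNNReal * c) μ := by
  have h2 : iIndepFun (fun i ω => v i * ξ i ω) μ :=
    hind.comp (fun i x => v i * x) fun i => by fun_prop
  refine HasSubgaussianMGF.sum_of_iIndepFun h2 fun i _ => ?_
  rw [Real.toNNReal_of_nonneg (sq_nonneg (v i))]
  exact (hξ i).const_mul (v i)

omit [Fintype ι] [DecidableEq ι] in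
lemma lintegral_exp_sq_linear_le (ha : 0 < a) (hind : iIndepFun ξ μ) (hm : ∀ i, Measurable (ξ i))
    (hξ : ∀ i, HasSubgaussianMGF (ξ i) (8 / a).toNNReal μ) (s : Finset ι) (v : ι → ℝ)
    (hv : ∑ i ∈ s, v i ^ 2 ≤ 1) {r : ℝ} (hr : 32 * r ≤ a) :
    ∫⁻ ω, ENNReal.ofReal (Real.exp (r * (∑ i ∈ s, v i * ξ i ω) ^ 2)) ∂μ ≤ 3 := by
  refine lintegral_exp_mul_sq_le_of_hasSubgaussianMGF (v := 8 / a)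
    (hasSubgaussianMGF_linear hind hξ s v) (by fun_prop) (by positivity) ?_ ?_
  · rw [← Finset.sum_mul, NNReal.coe_mul, Real.coe_toNNReal _ (by positivity)]
    simp only [NNReal.coe_sum, Real.coe_toNNReal _ (sq_nonneg (v _))]
    calc _ ≤ 1 * (8 / a) := by gcongr
      _ = _ := one_mul _
  · rw [show 4 * (8 / a) * r = 32 * r / a by ring, div_le_one ha]
    exact hr

omit [IsProbabilityMeasure μ] [Fintype ι] [DecidableEq ι] in
lemma lintegral_exp_linear_le (ha : 0 < a) (hind : iIndepFun ξ μ)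
    (hξ : ∀ i, HasSubgaussianMGF (ξ i) (8 / a).toNNReal μ) (s : Finset ι) (v : ι → ℝ) :
    ∫⁻ ω, ENNReal.ofReal (Real.exp (∑ i ∈ s, v i * ξ i ω)) ∂μ ≤
      ENNReal.ofReal (Real.exp (4 / a * ∑ i ∈ s, v i ^ 2)) := by
  have h := hasSubgaussianMGF_linear hind hξ s v
  have hi := h.integrable_exp_mul 1
  have hle := h.mgf_le 1
  simp only [mgf, one_mul] at hi hle
  rw [← ofReal_integral_eq_lintegral_ofReal hi
    (Filter.Eventually.of_forall fun _ => (Real.exp_pos _).le)]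
  refine ENNReal.ofReal_le_ofReal (hle.trans (Real.exp_le_exp.2 (le_of_eq ?_)))
  rw [← Finset.sum_mul, NNReal.coe_mul, Real.coe_toNNReal _ (by positivity)]
  simp only [NNReal.coe_sum, Real.coe_toNNReal _ (sq_nonneg (v _))]
  ring

/-- A bilinear form in two independent blocks of coordinates. -/
lemma lintegral_exp_cut_le (ha : 0 < a) (hind : iIndepFun ξ μ) (hm : ∀ i, Measurable (ξ i))
    (hξ : ∀ i, HasSubgaussianMGF (ξ i) (8 / a).toNNReal μ) (M : ι → ι → ℝ) (E : Finset ι)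
    (hM : 128 * ∑ i, ∑ j, M i j ^ 2 ≤ a ^ 2) :
    ∫⁻ ω, ENNReal.ofReal (Real.exp (∑ i ∈ E, ∑ j ∈ Eᶜ, M i j * ξ i ω * ξ j ω)) ∂μ ≤ 3 := by
  -- With the block Eᶜ frozen, the form is linear in the block E; its moment generating function
  -- leaves a sum of squares of linear forms in Eᶜ.
  have hcond : ∫⁻ ω, ENNReal.ofReal (Real.exp (∑ i ∈ E, ∑ j ∈ Eᶜ, M i j * ξ i ω * ξ j ω)) ∂μ ≤
      ∫⁻ ω, ENNReal.ofReal (Real.exp (4 / a * ∑ i ∈ E, (∑ j ∈ Eᶜ, M i j * ξ j ω) ^ 2)) ∂μ := by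
    have hE := hind.indepFun_finset E Eᶜ disjoint_compl_right hm
    have := lintegral_comp_le_of_indepFun (by fun_prop) (by fun_prop) hE
      (F := fun x y => ENNReal.ofReal (Real.exp (∑ i : E, (∑ j : (Eᶜ : Finset ι), M i j * y j) * x i)))
      (G := fun y => ENNReal.ofReal
        (Real.exp (4 / a * ∑ i : E, (∑ j : (Eᶜ : Finset ι), M i j * y j) ^ 2)))
      (by unfold Function.uncurry; fun_prop) (fun y => by
        have := lintegral_exp_linear_le ha hind hξ E
          (fun i => ∑ j : (Eᶜ : Finset ι), M i j * y j)
        rw [← Finset.sum_coe_sort E fun i => (∑ j : (Eᶜ : Finset ι), M i j * y j) ^ 2] at this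
        refine le_trans (le_of_eq ?_) this
        refine lintegral_congr fun ω => ?_
        rw [← Finset.sum_coe_sort E])
    refine le_trans (le_of_eq ?_) (this.trans (le_of_eq ?_))
    · refine lintegral_congr fun ω => ?_
      rw [← Finset.sum_coe_sort E]
      congr 2
      refine Finset.sum_congr rfl fun i _ => ?_
      rw [Finset.sum_coe_sort Eᶜ fun j => M i j * ξ j ω, Finset.sum_mul]
      exact Finset.sum_congr rfl fun j _ => by ring
    · refine lintegral_congr fun ω => ?_
      rw [← Finset.sum_coe_sort E]
      congr 3
      refine Finset.sum_congr rfl fun i _ => ?_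
      rw [Finset.sum_coe_sort Eᶜ fun j => M i j * ξ j ω]
  refine hcond.trans ?_
  -- Each row is normalized by its length: the weights become 128N_i²/a², of total at most 1, and
  -- each remaining term is a/32 times the square of a linear form with coefficient norm at most 1.
  set N : ι → ℝ := fun i => √(∑ j ∈ Eᶜ, M i j ^ 2) with hN
  have hNsq : ∀ i, N i ^ 2 = ∑ j ∈ Eᶜ, M i j ^ 2 := fun i =>
    Real.sq_sqrt (Finset.sum_nonneg fun _ _ => sq_nonneg _)
  have hMN : ∀ i, ∀ j ∈ Eᶜ, M i j = N i * (M i j / N i) := by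
    intro i j hj
    by_cases h0 : N i = 0
    · have h1 := hNsq i
      rw [h0, zero_pow two_ne_zero] at h1
      have := (Finset.sum_eq_zero_iff_of_nonneg fun _ _ => sq_nonneg _).1 h1.symm j hj
      simp [h0, pow_eq_zero_iff two_ne_zero |>.1 this]
    · field_simp
  have hrow : ∀ i ω, 4 / a * (∑ j ∈ Eᶜ, M i j * ξ j ω) ^ 2 =
      128 / a ^ 2 * N i ^ 2 * (a / 32 * (∑ j ∈ Eᶜ, M i j / N i * ξ j ω) ^ 2) := by
    intro i ω
    have : ∑ j ∈ Eᶜ, M i j * ξ j ω = N i * ∑ j ∈ Eᶜ, M i j / N i * ξ j ω := by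
      rw [Finset.mul_sum]
      refine Finset.sum_congr rfl fun j hj => ?_
      conv_lhs => rw [hMN i j hj]
      ring
    rw [this]
    field_simp
    ring
  simp_rw [Finset.mul_sum, hrow]
  refine lintegral_exp_sum_le (fun i _ => by positivity) ?_ (fun i => by fun_prop) (by norm_num) ?_
  · rw [← Finset.mul_sum, div_mul_eq_mul_div, div_le_one (by positivity)]
    refine le_trans ?_ hM
    gcongr
    simp_rw [hNsq]
    calc ∑ i ∈ E, ∑ j ∈ Eᶜ, M i j ^ 2 ≤ ∑ i ∈ E, ∑ j, M i j ^ 2 := by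
          gcongr; exact Finset.subset_univ _
      _ ≤ _ := Finset.sum_le_univ_sum_of_nonneg fun i => Finset.sum_nonneg fun _ _ => sq_nonneg _
  · intro i _
    refine lintegral_exp_sq_linear_le ha hind hm hξ _ _ ?_ (by linarith)
    simp_rw [div_pow]
    rw [← Finset.sum_div, ← hNsq]
    -- An inequality, not an equality: a zero row gives 0/0 = 0.
    exact div_self_le_one _

/-- The off-diagonal form is the uniform average over cuts of the cut forms of 4M, and convexity
reduces to one cut. The budget is 2048 = 128·4². -/
lemma lintegral_exp_offDiag_le (ha : 0 < a) (hind : iIndepFun ξ μ) (hm : ∀ i, Measurable (ξ i))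
    (hξ : ∀ i, HasSubgaussianMGF (ξ i) (8 / a).toNNReal μ) (M : ι → ι → ℝ)
    (hM : 2048 * ∑ i, ∑ j, M i j ^ 2 ≤ a ^ 2) :
    ∫⁻ ω, ENNReal.ofReal
      (Real.exp (∑ i, ∑ j, if i = j then 0 else M i j * ξ i ω * ξ j ω)) ∂μ ≤ 3 := by
  have hcard : (0 : ℝ) < Fintype.card (Finset ι) := by exact_mod_cast Fintype.card_pos
  have h := fun ω => four_mul_sum_cuts fun i j => M i j * ξ i ω * ξ j ω
  have hrw : ∀ ω, ∑ i, ∑ j, (if i = j then 0 else M i j * ξ i ω * ξ j ω) =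
      ∑ E : Finset ι, (Fintype.card (Finset ι) : ℝ)⁻¹ *
        ∑ i ∈ E, ∑ j ∈ Eᶜ, (4 * M i j) * ξ i ω * ξ j ω := by
    intro ω
    rw [← Finset.mul_sum, eq_inv_mul_iff_mul_eq₀ hcard.ne', ← h]
    simp_rw [Finset.mul_sum, mul_assoc]
  simp_rw [hrw]
  refine lintegral_exp_sum_le (fun i _ => by positivity) ?_ (fun i => by fun_prop) (by norm_num) ?_
  · simp
  · intro E _
    refine lintegral_exp_cut_le ha hind hm hξ (fun i j => 4 * M i j) E (le_trans (le_of_eq ?_) hM)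
    simp_rw [mul_pow, ← Finset.mul_sum]
    ring

omit [DecidableEq ι] in
-- Independence turns the moment into a product, and the budget 768 keeps the total exponent at most
-- 1, hence the value at most e < 3.
lemma lintegral_exp_diag_le (ha : 0 < a) (hind : iIndepFun ξ μ) (hm : ∀ i, Measurable (ξ i))
    {v : ι → ℝ} (hv : ∀ i, ∫ ω, ξ i ω ^ 2 ∂μ = v i)
    (hξ : ∀ i, ∫⁻ ω, ENNReal.ofReal (Real.exp (a / 2 * ξ i ω ^ 2)) ∂μ ≤ 3) (s : ι → ℝ)
    (hs : 768 * ∑ i, s i ^ 2 ≤ a ^ 2) :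
    ∫⁻ ω, ENNReal.ofReal (Real.exp (∑ i, s i * (ξ i ω ^ 2 - v i))) ∂μ ≤ 3 := by
  have hsi : ∀ i, |s i| ≤ a / 4 := by
    intro i
    refine abs_le_of_sq_le_sq ?_ (by positivity)
    have := Finset.single_le_sum (f := fun i => s i ^ 2) (fun i _ => sq_nonneg _)
      (Finset.mem_univ i)
    nlinarith [sq_nonneg (s i)]
  have hprod : ∀ ω, ENNReal.ofReal (Real.exp (∑ i, s i * (ξ i ω ^ 2 - v i))) =
      ∏ i, ENNReal.ofReal (Real.exp (s i * (ξ i ω ^ 2 - v i))) := by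
    intro ω
    rw [Real.exp_sum, ENNReal.ofReal_prod_of_nonneg fun _ _ => (Real.exp_pos _).le]
  simp_rw [hprod]
  have hind' : iIndepFun (fun i ω => ENNReal.ofReal (Real.exp (s i * (ξ i ω ^ 2 - v i)))) μ :=
    hind.comp (fun i x => ENNReal.ofReal (Real.exp (s i * (x ^ 2 - v i)))) fun i => by fun_prop
  rw [lintegral_prod_eq_prod_lintegral_of_indepFun _ _ hind' fun i => by fun_prop]
  calc _ ≤ ∏ i, ENNReal.ofReal (Real.exp (768 * s i ^ 2 / a ^ 2)) :=
        Finset.prod_le_prod' fun i _ => lintegral_exp_mul_sq_sub_le ha (hm i) (hv i) (hsi i) (hξ i)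
    _ = ENNReal.ofReal (Real.exp (∑ i, 768 * s i ^ 2 / a ^ 2)) := by
        rw [Real.exp_sum, ENNReal.ofReal_prod_of_nonneg fun _ _ => (Real.exp_pos _).le]
    _ ≤ ENNReal.ofReal 3 := by
        refine ENNReal.ofReal_le_ofReal ?_
        have : ∑ i, 768 * s i ^ 2 / a ^ 2 ≤ 1 := by
          rw [← Finset.sum_div, ← Finset.mul_sum, div_le_one (by positivity)]
          exact hs
        have h2 := Real.exp_one_lt_d9
        have := Real.exp_le_exp.2 this
        linarith
    _ = 3 := by simp

/-- Exponential moment of a centered quadratic form in independent sub-Gaussian variables. -/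
lemma lintegral_exp_quadraticForm_le (ha : 0 < a) (hind : iIndepFun ξ μ)
    (hm : ∀ i, Measurable (ξ i)) (hmean : ∀ i, ∫ ω, ξ i ω ∂μ = 0)
    {v : ι → ℝ} (hv : ∀ i, ∫ ω, ξ i ω ^ 2 ∂μ = v i)
    (hξ : ∀ i, ∫⁻ ω, ENNReal.ofReal (Real.exp (a / 2 * ξ i ω ^ 2)) ∂μ ≤ 3) (M : ι → ι → ℝ)
    (hM : 10000 * ∑ i, ∑ j, M i j ^ 2 ≤ a ^ 2) :
    ∫⁻ ω, ENNReal.ofReal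
      (Real.exp (∑ i, ∑ j, M i j * ξ i ω * ξ j ω - ∑ i, M i i * v i)) ∂μ ≤ 3 := by
  have hsub := fun i => hasSubgaussianMGF_of_exp_sq ha (hm i) (hmean i) (hξ i)
  have hM0 : 0 ≤ ∑ i, ∑ j, M i j ^ 2 :=
    Finset.sum_nonneg fun _ _ => Finset.sum_nonneg fun _ _ => sq_nonneg _
  have hoff := lintegral_exp_offDiag_le ha hind hm hsub (fun i j => 2 * M i j) (by
    simp_rw [mul_pow, ← Finset.mul_sum]
    linarith)
  have hdiagM : ∑ i, M i i ^ 2 ≤ ∑ i, ∑ j, M i j ^ 2 :=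
    Finset.sum_le_sum fun i _ => Finset.single_le_sum (f := fun j => M i j ^ 2)
      (fun _ _ => sq_nonneg _) (Finset.mem_univ i)
  have hdiag := lintegral_exp_diag_le ha hind hm hv hξ (fun i => 2 * M i i) (by
    simp_rw [mul_pow, ← Finset.mul_sum]
    linarith)
  -- Halving each part for convexity doubles its matrix: the costs are 2048·4 and 768·4, both below
  -- 10000.
  have hsplit : ∀ ω, ∑ i, ∑ j, M i j * ξ i ω * ξ j ω - ∑ i, M i i * v i =
      ∑ b : Bool, (1 / 2 : ℝ) * (if b then ∑ i, ∑ j, (if i = j then 0 else 2 * M i j * ξ i ω * ξ j ω)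
        else ∑ i, 2 * M i i * (ξ i ω ^ 2 - v i)) := by
    intro ω
    simp only [Fintype.sum_bool, if_true, Bool.false_eq_true, if_false]
    rw [Finset.mul_sum, Finset.mul_sum, ← Finset.sum_add_distrib, ← Finset.sum_sub_distrib]
    refine Finset.sum_congr rfl fun i _ => ?_
    have h1 : ∑ j, M i j * ξ i ω * ξ j ω =
        ∑ j, ((if i = j then M i j * ξ i ω * ξ j ω else 0) +
          (if i = j then 0 else M i j * ξ i ω * ξ j ω)) :=
      Finset.sum_congr rfl fun j _ => by split_ifs <;> simp
    have h2 : 1 / 2 * ∑ j, (if i = j then 0 else 2 * M i j * ξ i ω * ξ j ω) =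
        ∑ j, (if i = j then 0 else M i j * ξ i ω * ξ j ω) := by
      rw [Finset.mul_sum]
      exact Finset.sum_congr rfl fun j _ => by split_ifs <;> ring
    rw [h1, h2, Finset.sum_add_distrib]
    simp only [Finset.sum_ite_eq, Finset.mem_univ, if_true]
    ring
  simp_rw [hsplit]
  refine lintegral_exp_sum_le (fun i _ => by positivity) (by norm_num) ?_ (by norm_num) ?_
  · rintro (_ | _)
    · simp only [Bool.false_eq_true, if_false]; fun_prop
    · simp only [if_true]
      refine Finset.measurable_fun_sum _ fun i _ => Finset.measurable_fun_sum _ fun j _ => ?_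
      split_ifs <;> fun_prop
  · rintro (_ | _) _
    · simpa using hdiag
    · simpa using hoff

/-- A weak form of the Hanson-Wright inequality, with the Hilbert-Schmidt norm only. -/
lemma measure_quadraticForm_le (ha : 0 < a) (hind : iIndepFun ξ μ)
    (hm : ∀ i, Measurable (ξ i)) (hmean : ∀ i, ∫ ω, ξ i ω ∂μ = 0)
    {v : ι → ℝ} (hv : ∀ i, ∫ ω, ξ i ω ^ 2 ∂μ = v i)
    (hξ : ∀ i, ∫⁻ ω, ENNReal.ofReal (Real.exp (a / 2 * ξ i ω ^ 2)) ∂μ ≤ 3) (M : ι → ι → ℝ)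
    {F : ℝ} (hF : 0 < F) (hM : ∑ i, ∑ j, M i j ^ 2 ≤ F ^ 2) (L : ℝ) :
    μ.real {ω | 100 * F / a * L < |∑ i, ∑ j, M i j * ξ i ω * ξ j ω - ∑ i, M i i * v i|} ≤
      6 * Real.exp (-L) := by
  set Q : Ω → ℝ := fun ω => ∑ i, ∑ j, M i j * ξ i ω * ξ j ω - ∑ i, M i i * v i with hQ
  have hQm : Measurable Q := by fun_prop
  -- ε = ±1 covers the two tails; the scaling a/(100F) meets the budget 10000 = 100², and Markov's
  -- inequality follows.
  have key : ∀ ε : ℝ, ε ^ 2 = 1 →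
      μ.real {ω | L ≤ a / (100 * F) * (ε * Q ω)} ≤ 3 * Real.exp (-L) := by
    intro ε hε
    have h1 := lintegral_exp_quadraticForm_le ha hind hm hmean hv hξ
      (fun i j => a / (100 * F) * ε * M i j) (by
        simp_rw [mul_pow, ← Finset.mul_sum, hε]
        rw [div_pow, mul_pow]
        calc _ ≤ 10000 * (a ^ 2 / (100 ^ 2 * F ^ 2) * 1 * F ^ 2) := by gcongr
          _ = a ^ 2 := by field_simp; norm_num)
    have h2 : ∀ ω, ∑ i, ∑ j, a / (100 * F) * ε * M i j * ξ i ω * ξ j ω -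
        ∑ i, a / (100 * F) * ε * M i i * v i = a / (100 * F) * (ε * Q ω) := by
      intro ω
      simp only [hQ, mul_sub, Finset.mul_sum, mul_assoc]
    simp_rw [h2] at h1
    have h3 := mul_meas_ge_le_lintegral₀ (μ := μ)
      (f := fun ω => ENNReal.ofReal (Real.exp (a / (100 * F) * (ε * Q ω)))) (by fun_prop)
      (ENNReal.ofReal (Real.exp L))
    have h4 : {ω | L ≤ a / (100 * F) * (ε * Q ω)} = {ω | ENNReal.ofReal (Real.exp L) ≤
        ENNReal.ofReal (Real.exp (a / (100 * F) * (ε * Q ω)))} := by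
      ext ω
      change _ ↔ ENNReal.ofReal (Real.exp L) ≤ ENNReal.ofReal (Real.exp (a / (100 * F) * (ε * Q ω)))
      rw [ENNReal.ofReal_le_ofReal_iff (Real.exp_pos _).le, Real.exp_le_exp]
      rfl
    rw [← h4] at h3
    have h5 := ENNReal.toReal_mono (by simp) (h3.trans h1)
    rw [ENNReal.toReal_mul, ENNReal.toReal_ofReal (Real.exp_pos _).le] at h5
    rw [Real.exp_neg, ← div_eq_mul_inv, le_div_iff₀ (Real.exp_pos _), mul_comm]
    simpa [Measure.real] using h5
  have hsub : {ω | 100 * F / a * L < |Q ω|} ⊆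
      {ω | L ≤ a / (100 * F) * (1 * Q ω)} ∪ {ω | L ≤ a / (100 * F) * (-1 * Q ω)} := by
    intro ω hω
    have hω' : 100 * F / a * L < |Q ω| := hω
    have hmul : ∀ x, 100 * F / a * L < x → L ≤ a / (100 * F) * x := by
      intro x hx
      calc L = a / (100 * F) * (100 * F / a * L) := by field_simp
        _ ≤ _ := by gcongr
    rcases lt_abs.1 hω' with h | h
    · exact Or.inl (hmul _ (by linarith))
    · exact Or.inr (hmul _ (by linarith))
  calc _ ≤ _ := measureReal_mono hsub
    _ ≤ _ := measureReal_union_le _ _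
    _ ≤ _ := add_le_add (key 1 (by norm_num)) (key (-1) (by norm_num))
    _ = _ := by ring

omit [IsProbabilityMeasure μ] in
/-- Two independent families of independent random variables form one independent family. -/
lemma iIndepFun_sumElim {ι₁ ι₂ : Type*} {X : ι₁ → Ω → ℝ} {Z : ι₂ → Ω → ℝ}
    (hX : iIndepFun X μ) (hZ : iIndepFun Z μ)
    (hXZ : IndepFun (fun ω i => X i ω) (fun ω i => Z i ω) μ) :
    iIndepFun (Sum.elim X Z) μ := by
  rw [iIndepFun_iff_measure_inter_preimage_eq_mul] at hX hZ ⊢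
  intro S sets hS
  have h1 := hX S.toLeft (sets := fun i => sets (Sum.inl i))
    fun i hi => hS _ (Finset.mem_toLeft.1 hi)
  have h2 := hZ S.toRight (sets := fun i => sets (Sum.inr i))
    fun i hi => hS _ (Finset.mem_toRight.1 hi)
  have h3 := hXZ.measure_inter_preimage_eq_mul
    (⋂ i ∈ S.toLeft, (fun x : ι₁ → ℝ => x i) ⁻¹' sets (Sum.inl i))
    (⋂ i ∈ S.toRight, (fun x : ι₂ → ℝ => x i) ⁻¹' sets (Sum.inr i))
    (Finset.measurableSet_biInter _ fun i hi =>
      (hS _ (Finset.mem_toLeft.1 hi)).preimage (measurable_pi_apply i))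
    (Finset.measurableSet_biInter _ fun i hi =>
      (hS _ (Finset.mem_toRight.1 hi)).preimage (measurable_pi_apply i))
  simp only [Set.preimage_iInter, ← Set.preimage_comp, Function.comp_def] at h3
  rw [h1, h2] at h3
  have hset : (⋂ i ∈ S, Sum.elim X Z i ⁻¹' sets i) =
      (⋂ i ∈ S.toLeft, X i ⁻¹' sets (Sum.inl i)) ∩ ⋂ i ∈ S.toRight, Z i ⁻¹' sets (Sum.inr i) := by
    ext ω
    simp
  rw [hset, h3, ← Finset.toLeft_disjSum_toRight (u := S)]
  simp

end Independence

/-! ### Norms in coordinates. -/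

section Norms

variable {m k : Type*} [Fintype m] [Fintype k]

lemma euclNorm_sq (v : m → ℝ) : euclNorm v ^ 2 = ∑ i, v i ^ 2 := by
  rw [euclNorm, EuclideanSpace.norm_sq_eq]
  simp

lemma hsNorm_sq (A : Matrix m k ℝ) : hsNorm A ^ 2 = ∑ i, ∑ j, A i j ^ 2 := by
  rw [hsNorm, Matrix.frobenius_norm_def, ← Real.sqrt_eq_rpow, Real.sq_sqrt]
  · simp
  · positivity

end Norms

/-! ### The adjoint of the observed summation operator. -/

section SumObs

variable {T n : ℕ}

/-- The adjoint of prefix summation is tail summation; both spectral estimates work with these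
tails. -/
lemma transpose_mulVec_obsOp_sumOp (u : Fin T → EuclideanSpace ℝ (Fin n)) (w : Fin T → ℝ)
    (b : Fin T × Fin n) :
    ((obsOp u * sumOp T n)ᵀ *ᵥ w) b = ∑ t : Fin T, if b.1 ≤ t then w t * u t b.2 else 0 := by
  rw [Matrix.mulVec, dotProduct]
  refine Finset.sum_congr rfl fun t _ => ?_
  rw [Matrix.transpose_apply, Matrix.mul_apply, Fintype.sum_prod_type, Finset.sum_eq_single t]
  · simp only [obsOp, sumOp, Matrix.of_apply, if_true]
    rw [Finset.sum_eq_single b.2]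
    · by_cases h : b.1 ≤ t <;> simp [h, mul_comm]
    · intro j _ hj
      simp [hj.symm]
    · simp
  · intro s _ hs
    simp [obsOp, hs]
  · simp

/-- The difference operator, inverse to summation, has norm at most two. -/
lemma sum_sq_le_four_mul_tailSum (x : Fin T → ℝ) :
    ∑ t, x t ^ 2 ≤ 4 * ∑ s : Fin T, (∑ t : Fin T, if s ≤ t then x t else 0) ^ 2 := by
  -- Tails are indexed by ℕ so that the empty tail g T = 0 is available and x_t = g t - g (t+1)
  -- holds up to the last index.
  set g : ℕ → ℝ := fun s => ∑ t : Fin T, if s ≤ (t : ℕ) then x t else 0 with hg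
  have hgT : g T = 0 := Finset.sum_eq_zero fun t _ => if_neg (by omega)
  have hx : ∀ t : Fin T, x t = g t - g (t + 1) := by
    intro t
    rw [hg, ← Finset.sum_sub_distrib, Finset.sum_eq_single t]
    · simp
    · intro s _ hs
      have : (t : ℕ) ≠ s := fun h => hs (Fin.ext h.symm)
      by_cases h : (t : ℕ) ≤ s
      · rw [if_pos h, if_pos (by omega), sub_self]
      · rw [if_neg h, if_neg (by omega), sub_self]
    · simp
  have hgs : ∀ s : Fin T, (∑ t : Fin T, if s ≤ t then x t else 0) = g s := fun s => rfl
  have hshift : ∑ t : Fin T, g (t + 1) ^ 2 ≤ ∑ t : Fin T, g t ^ 2 := by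
    rw [Fin.sum_univ_eq_sum_range (fun t => g (t + 1) ^ 2),
      Fin.sum_univ_eq_sum_range (fun t => g t ^ 2)]
    have h1 := Finset.sum_range_succ (fun t => g t ^ 2) T
    have h2 := Finset.sum_range_succ' (fun t => g t ^ 2) T
    rw [hgT] at h1
    nlinarith [sq_nonneg (g 0)]
  simp_rw [hgs]
  calc ∑ t, x t ^ 2 ≤ ∑ t : Fin T, (2 * g t ^ 2 + 2 * g (t + 1) ^ 2) := by
        refine Finset.sum_le_sum fun t _ => ?_
        rw [hx t]
        nlinarith [sq_nonneg (g t + g (t + 1))]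
    _ = 2 * ∑ t : Fin T, g t ^ 2 + 2 * ∑ t : Fin T, g (t + 1) ^ 2 := by
        rw [Finset.sum_add_distrib, Finset.mul_sum, Finset.mul_sum]
    _ ≤ _ := by linarith

/-- In each coordinate j, differencing the tails recovers w_t u_t(j); summing over j then gives
w_t²‖u_t‖². -/
lemma sq_mul_sum_sq_le {u : Fin T → EuclideanSpace ℝ (Fin n)} {r : ℝ} (hr : 0 ≤ r)
    (hu : ∀ t, r ≤ ‖u t‖) (w : Fin T → ℝ) :
    r ^ 2 * ∑ t, w t ^ 2 ≤ 4 * ∑ b, ((obsOp u * sumOp T n)ᵀ *ᵥ w) b ^ 2 := by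
  simp_rw [transpose_mulVec_obsOp_sumOp]
  rw [Fintype.sum_prod_type_right, Finset.mul_sum, Finset.mul_sum]
  calc ∑ t, r ^ 2 * w t ^ 2 ≤ ∑ t, ∑ j, (w t * u t j) ^ 2 := by
        refine Finset.sum_le_sum fun t _ => ?_
        have h : ∑ j, u t j ^ 2 = ‖u t‖ ^ 2 := by rw [EuclideanSpace.norm_sq_eq]; simp
        simp_rw [mul_pow, ← Finset.mul_sum]
        rw [h, mul_comm]
        gcongr
        exact hu t
    _ = ∑ j, ∑ t, (w t * u t j) ^ 2 := Finset.sum_comm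
    _ ≤ _ := Finset.sum_le_sum fun j _ => sum_sq_le_four_mul_tailSum fun t => w t * u t j

lemma card_filter_div_eq_le (N k : ℕ) (hN : 0 < N) :
    (Finset.univ.filter fun s : Fin T => (s : ℕ) / N = k).card ≤ N := by
  calc _ ≤ (Finset.Ico (k * N) (k * N + N)).card := by
        refine Finset.card_le_card_of_injOn (fun s => (s : ℕ)) ?_ Fin.val_injective.injOn
        intro s hs
        simp only [Finset.coe_filter, Finset.mem_univ, true_and] at hs
        have hs' : (s : ℕ) / N = k := hs
        have h1 := Nat.div_mul_le_self (s : ℕ) N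
        have h2 := Nat.lt_div_mul_add (a := (s : ℕ)) hN
        rw [hs'] at h1 h2
        simp only [Finset.coe_Ico, Set.mem_Ico]
        omega
    _ = N := by simp

/-- If the sums of `w_t u_t` over blocks of length `N` vanish, the adjoint of the observed summation
operator acts on `w` with norm at most `N` times the largest `‖u_t‖`. -/
lemma sum_sq_transpose_mulVec_le {u : Fin T → EuclideanSpace ℝ (Fin n)} {r : ℝ}
    (hu : ∀ t, ‖u t‖ ≤ r) (w : Fin T → ℝ) {N : ℕ} (hN : 0 < N)
    (hw : ∀ (k : ℕ) (j : Fin n),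
      ∑ t : Fin T, (if (k + 1) * N ≤ (t : ℕ) then w t * u t j else 0) = 0) :
    ∑ b, ((obsOp u * sumOp T n)ᵀ *ᵥ w) b ^ 2 ≤ (N * r) ^ 2 * ∑ t, w t ^ 2 := by
  set J : Fin T → Finset (Fin T) := fun s => Finset.univ.filter fun t => (t : ℕ) / N = (s : ℕ) / N
    with hJ
  have hblock : ∀ s : Fin T, ∀ j, (∑ t : Fin T, if s ≤ t then w t * u t j else 0) =
      ∑ t ∈ J s, (if s ≤ t then w t else 0) * u t j := by
    intro s j
    -- The tail starting at the next multiple of N vanishes, so subtracting it leaves only the part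
    -- of the tail inside the block of s.
    have hsub : (∑ t : Fin T, if s ≤ t then w t * u t j else 0) =
        (∑ t : Fin T, if s ≤ t then w t * u t j else 0) -
          ∑ t : Fin T, if ((s : ℕ) / N + 1) * N ≤ (t : ℕ) then w t * u t j else 0 := by
      rw [hw, sub_zero]
    rw [hJ, Finset.sum_filter, hsub, ← Finset.sum_sub_distrib]
    refine Finset.sum_congr rfl fun t _ => ?_
    have hiff : ((s : ℕ) / N + 1) * N ≤ (t : ℕ) ↔ (s : ℕ) / N < (t : ℕ) / N := by
      rw [← Nat.le_div_iff_mul_le hN]; rfl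
    simp only [hiff]
    by_cases hst : s ≤ t
    · have hdiv : (s : ℕ) / N ≤ (t : ℕ) / N := Nat.div_le_div_right hst
      rcases hdiv.eq_or_lt with h | h
      · simp [hst, h]
      · simp [hst, h, h.ne']
    · have hdiv : (t : ℕ) / N ≤ (s : ℕ) / N := Nat.div_le_div_right (not_le.1 hst).le
      simp [hst, hdiv.not_gt]
  have hnorm : ∀ t, ∑ j, u t j ^ 2 ≤ r ^ 2 := by
    intro t
    have h : ∑ j, u t j ^ 2 = ‖u t‖ ^ 2 := by rw [EuclideanSpace.norm_sq_eq]; simp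
    rw [h]
    gcongr
    exact hu t
  have hrow : ∀ s : Fin T, ∑ j, (∑ t : Fin T, if s ≤ t then w t * u t j else 0) ^ 2 ≤
      N * r ^ 2 * ∑ t ∈ J s, w t ^ 2 := by
    intro s
    calc _ = ∑ j, (∑ t ∈ J s, (if s ≤ t then w t else 0) * u t j) ^ 2 := by simp_rw [hblock]
      _ ≤ ∑ j, (∑ t ∈ J s, (if s ≤ t then w t else 0) ^ 2) * ∑ t ∈ J s, u t j ^ 2 :=
          Finset.sum_le_sum fun j _ => Finset.sum_mul_sq_le_sq_mul_sq _ _ _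
      _ = (∑ t ∈ J s, (if s ≤ t then w t else 0) ^ 2) * ∑ t ∈ J s, ∑ j, u t j ^ 2 := by
          rw [← Finset.mul_sum, Finset.sum_comm]
      _ ≤ (∑ t ∈ J s, w t ^ 2) * ∑ t ∈ J s, r ^ 2 := by
          refine mul_le_mul (Finset.sum_le_sum fun t _ => ?_) (Finset.sum_le_sum fun t _ => hnorm t)
            (Finset.sum_nonneg fun t _ => Finset.sum_nonneg fun _ _ => sq_nonneg _)
            (Finset.sum_nonneg fun t _ => sq_nonneg _)
          split_ifs
          · exact le_rfl
          · simpa using sq_nonneg (w t)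
      _ ≤ (∑ t ∈ J s, w t ^ 2) * (N * r ^ 2) := by
          rw [Finset.sum_const, nsmul_eq_mul]
          gcongr
          exact card_filter_div_eq_le N _ hN
      _ = _ := mul_comm _ _
  simp_rw [transpose_mulVec_obsOp_sumOp]
  rw [Fintype.sum_prod_type]
  calc _ ≤ ∑ s : Fin T, N * r ^ 2 * ∑ t ∈ J s, w t ^ 2 := Finset.sum_le_sum fun s _ => hrow s
    -- Lying in the same block is symmetric, and each t is counted by at most N indices s: this is
    -- the second factor N, after the one from Cauchy–Schwarz.
    _ = N * r ^ 2 * ∑ t, ∑ s ∈ J t, w t ^ 2 := by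
        rw [← Finset.mul_sum]
        congr 1
        refine Finset.sum_comm' fun s t => ?_
        simp [hJ, eq_comm]
    _ ≤ N * r ^ 2 * ∑ t, N * w t ^ 2 := by
        gcongr with t _
        rw [Finset.sum_const, nsmul_eq_mul]
        gcongr
        exact card_filter_div_eq_le N _ hN
    _ = _ := by rw [← Finset.mul_sum]; ring

end SumObs

/-! ### Filtered inverses and the singular value decomposition. -/

namespace SVD

variable {T : ℕ} {m : Type*} [Fintype m] {A : Matrix (Fin T) m ℝ}

/-- The regularized inverse `W* Diag(q_i / γ_i) U*`. -/
noncomputable def filteredInverse (D : SVD A) (q : Fin T → ℝ) : Matrix m (Fin T) ℝ :=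
  D.Wᵀ * Matrix.diagonal (fun i => q i * (D.γ i)⁻¹) * D.Uᵀ

lemma R_eq (D : SVD A) : D.R = D.filteredInverse fun _ => 1 := by
  simp [R, filteredInverse, χ]

lemma R'_eq (D : SVD A) (p : ℕ) :
    D.R' p = D.filteredInverse fun i => if (Fin.rev i : ℕ) < p then 1 else 0 := by
  simp only [R', filteredInverse, χ, Fin.rev_rev]
  congr 3
  ext i
  split_ifs <;> simp

lemma transpose_mul_U (D : SVD A) : D.Uᵀ * D.U = 1 := by
  simpa [Matrix.star_eq_conjTranspose] using Matrix.mem_orthogonalGroup_iff' _ _ |>.1 D.U_orthogonal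

lemma sum_W_mul_W (D : SVD A) (i j : Fin T) : ∑ b, D.W i b * D.W j b = if i = j then 1 else 0 := by
  have := congrFun (congrFun D.W_orthonormal i) j
  simpa [Matrix.mul_apply, Matrix.one_apply] using this

lemma sum_U_mul_U (D : SVD A) (i j : Fin T) : ∑ t, D.U t i * D.U t j = if i = j then 1 else 0 := by
  have := congrFun (congrFun D.transpose_mul_U i) j
  simpa [Matrix.mul_apply, Matrix.one_apply] using this

lemma sum_sq_transpose_W_mulVec (D : SVD A) (x : Fin T → ℝ) :
    ∑ b, (D.Wᵀ *ᵥ x) b ^ 2 = ∑ i, x i ^ 2 := by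
  have h : (D.Wᵀ *ᵥ x) ⬝ᵥ (D.Wᵀ *ᵥ x) = x ⬝ᵥ x := by
    rw [Matrix.dotProduct_mulVec, Matrix.vecMul_transpose, Matrix.mulVec_mulVec, D.W_orthonormal,
      Matrix.one_mulVec]
  simpa [dotProduct, pow_two] using h

lemma sum_sq_U_mulVec (D : SVD A) (x : Fin T → ℝ) :
    ∑ b, (D.U *ᵥ x) b ^ 2 = ∑ i, x i ^ 2 := by
  have h : (D.U *ᵥ x) ⬝ᵥ (D.U *ᵥ x) = x ⬝ᵥ x := by
    rw [Matrix.dotProduct_mulVec, ← Matrix.mulVec_transpose, Matrix.mulVec_mulVec,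
      D.transpose_mul_U, Matrix.one_mulVec]
  simpa [dotProduct, pow_two] using h

lemma sum_sq_transpose_mulVec_U (D : SVD A) (x : Fin T → ℝ) :
    ∑ b, (Aᵀ *ᵥ (D.U *ᵥ x)) b ^ 2 = ∑ i, (D.γ i * x i) ^ 2 := by
  have h : Aᵀ *ᵥ (D.U *ᵥ x) = D.Wᵀ *ᵥ (fun i => D.γ i * x i) := by
    rw [congrArg Matrix.transpose D.eq_mul, Matrix.transpose_mul, Matrix.transpose_mul,
      Matrix.diagonal_transpose, Matrix.mulVec_mulVec,
      Matrix.mul_assoc, Matrix.mul_assoc, D.transpose_mul_U, Matrix.mul_one, ← Matrix.mulVec_mulVec]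
    congr 1
    ext i
    rw [Matrix.mulVec_diagonal]
  rw [h, D.sum_sq_transpose_W_mulVec]

lemma hsNorm_filteredInverse_sq (D : SVD A) (q : Fin T → ℝ) :
    hsNorm (D.filteredInverse q) ^ 2 = ∑ i, (q i * (D.γ i)⁻¹) ^ 2 := by
  rw [hsNorm_sq, Finset.sum_comm]
  have h : ∀ t b, D.filteredInverse q b t =
      (D.Wᵀ *ᵥ fun i => q i * (D.γ i)⁻¹ * D.U t i) b := by
    intro t b
    rw [filteredInverse, Matrix.mul_apply, Matrix.mulVec, dotProduct]
    refine Finset.sum_congr rfl fun i _ => ?_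
    rw [Matrix.mul_diagonal, Matrix.transpose_apply D.U]
    ring
  simp_rw [h, D.sum_sq_transpose_W_mulVec]
  rw [Finset.sum_comm]
  refine Finset.sum_congr rfl fun i _ => ?_
  have := D.sum_U_mul_U i i
  rw [if_pos rfl] at this
  simp_rw [mul_pow _ (D.U _ i), ← Finset.mul_sum, pow_two (D.U _ i)]
  rw [this, mul_one]

/-- The rows of the matrix `[W, Diag(γ)⁻¹ U*]`, weighted by `q`. -/
noncomputable def noiseRow (D : SVD A) (q : Fin T → ℝ) (i : Fin T) : m ⊕ Fin T → ℝ :=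
  Sum.elim (fun b => q i * D.W i b) fun t => q i * (D.γ i)⁻¹ * D.U t i

/-- W* preserves length, and in U*A = Diag(γ)W the factor γ_i cancels against the inverse, so the
signal enters only through Wh. -/
lemma euclNorm_filteredInverse_mulVec_sq (D : SVD A) (q : Fin T → ℝ) (h : m → ℝ) (z : Fin T → ℝ) :
    euclNorm (D.filteredInverse q *ᵥ (A *ᵥ h + z)) ^ 2 =
      ∑ i, (∑ k, D.noiseRow q i k * Sum.elim h z k) ^ 2 := by
  rw [euclNorm_sq, filteredInverse, ← Matrix.mulVec_mulVec, ← Matrix.mulVec_mulVec,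
    D.sum_sq_transpose_W_mulVec]
  refine Finset.sum_congr rfl fun i _ => ?_
  congr 1
  have hA : D.Uᵀ *ᵥ (A *ᵥ h) = Matrix.diagonal D.γ *ᵥ (D.W *ᵥ h) := by
    rw [congrArg (· *ᵥ h) D.eq_mul, Matrix.mulVec_mulVec, Matrix.mulVec_mulVec,
      ← Matrix.mul_assoc, ← Matrix.mul_assoc,
      D.transpose_mul_U, Matrix.one_mul]
  rw [Matrix.mulVec_diagonal, Matrix.mulVec_add, hA, Pi.add_apply, Matrix.mulVec_diagonal,
    Fintype.sum_sum_type]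
  simp only [noiseRow, Sum.elim_inl, Sum.elim_inr, mul_assoc, ← Finset.mul_sum]
  have hγ := (D.γ_pos i).ne'
  simp only [Matrix.mulVec, dotProduct, Matrix.transpose_apply]
  field_simp

lemma sum_noiseRow_mul (D : SVD A) (q : Fin T → ℝ) (i j : Fin T) :
    ∑ k, D.noiseRow q i k * D.noiseRow q j k =
      if i = j then q i ^ 2 * (1 + ((D.γ i)⁻¹) ^ 2) else 0 := by
  rw [Fintype.sum_sum_type]
  simp only [noiseRow, Sum.elim_inl, Sum.elim_inr]
  have h1 : ∑ b, q i * D.W i b * (q j * D.W j b) = q i * q j * ∑ b, D.W i b * D.W j b := by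
    rw [Finset.mul_sum]; exact Finset.sum_congr rfl fun _ _ => by ring
  have h2 : ∑ t, q i * (D.γ i)⁻¹ * D.U t i * (q j * (D.γ j)⁻¹ * D.U t j) =
      q i * (D.γ i)⁻¹ * (q j * (D.γ j)⁻¹) * ∑ t, D.U t i * D.U t j := by
    rw [Finset.mul_sum]; exact Finset.sum_congr rfl fun _ _ => by ring
  rw [h1, h2, D.sum_W_mul_W, D.sum_U_mul_U]
  split_ifs with h
  · subst h; ring
  · simp

end SVD

/-! ### Bounds on the singular values. -/

section Spectrum

variable {T n : ℕ} {u : Fin T → EuclideanSpace ℝ (Fin n)}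

/-- The lower bound for the adjoint is tested on the i-th left singular vector. -/
lemma inv_γ_sq_le (D : SVD (obsOp u * sumOp T n)) {r : ℝ} (hr : 0 < r) (hu : ∀ t, r ≤ ‖u t‖)
    (i : Fin T) : ((D.γ i)⁻¹) ^ 2 ≤ 4 * (r ^ 2)⁻¹ := by
  have h := sq_mul_sum_sq_le hr.le hu (D.U *ᵥ Pi.single i 1)
  rw [D.sum_sq_transpose_mulVec_U, D.sum_sq_U_mulVec] at h
  have h1 : ∑ j, (Pi.single i (1 : ℝ) : Fin T → ℝ) j ^ 2 = 1 := by
    rw [Finset.sum_eq_single i] <;> simp +contextual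
  have h2 : ∑ j, (D.γ j * (Pi.single i (1 : ℝ) : Fin T → ℝ) j) ^ 2 = D.γ i ^ 2 := by
    rw [Finset.sum_eq_single i] <;> simp +contextual
  rw [h1, h2, mul_one] at h
  rw [inv_pow, ← div_eq_mul_inv, inv_le_comm₀ (pow_pos (D.γ_pos i) 2) (by positivity), inv_div,
    div_le_iff₀ (by norm_num)]
  linarith

/-- Dimension count: on the span of the left singular vectors with γ_i > 2nr the adjoint stretches
every nonzero vector by more than 2nr, while it stretches by at most 2nr once the tail sums at
multiples of 2n vanish. So these constraints are injective on that span, which bounds its dimension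
by their number. -/
lemma two_mul_card_large_γ_le (D : SVD (obsOp u * sumOp T n)) (hT : 1 ≤ T) (hn : 1 ≤ n) {r : ℝ}
    (hu : ∀ t, ‖u t‖ ≤ r) :
    2 * (Finset.univ.filter fun i => ((2 * n : ℕ) * r) ^ 2 < D.γ i ^ 2).card ≤ T := by
  set I := Finset.univ.filter fun i => ((2 * n : ℕ) * r) ^ 2 < D.γ i ^ 2 with hI
  -- The number of positive multiples of 2n below T. Later tails are empty, so there are Kn ≤ (T -
  -- 1)/2 constraints.
  set K := (T - 1) / (2 * n) with hK
  let ext0 : (I → ℝ) →ₗ[ℝ] (Fin T → ℝ) :=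
    { toFun := fun y i => if h : i ∈ I then y ⟨i, h⟩ else 0
      map_add' := fun y y' => by ext i; simp only [Pi.add_apply]; split_ifs <;> simp
      map_smul' := fun c y => by
        ext i; simp only [Pi.smul_apply, RingHom.id_apply]; split_ifs <;> simp }
  let Ψ : (Fin T → ℝ) →ₗ[ℝ] (Fin K × Fin n → ℝ) :=
    { toFun := fun w b => ∑ t : Fin T,
        if ((b.1 : ℕ) + 1) * (2 * n) ≤ (t : ℕ) then w t * u t b.2 else 0
      map_add' := fun w w' => by
        ext b
        simp only [Pi.add_apply]
        rw [← Finset.sum_add_distrib]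
        exact Finset.sum_congr rfl fun t _ => by split_ifs <;> ring
      map_smul' := fun c w => by
        ext b
        simp only [Pi.smul_apply, RingHom.id_apply, smul_eq_mul]
        rw [Finset.mul_sum]
        exact Finset.sum_congr rfl fun t _ => by split_ifs <;> ring }
  let Φ := Ψ ∘ₗ Matrix.mulVecLin D.U ∘ₗ ext0
  have hinj : Function.Injective Φ := by
    rw [← LinearMap.ker_eq_bot, LinearMap.ker_eq_bot']
    intro y hy
    have hconstr : ∀ (k : ℕ) (j : Fin n), ∑ t : Fin T,
        (if (k + 1) * (2 * n) ≤ (t : ℕ) then (D.U *ᵥ ext0 y) t * u t j else 0) = 0 := by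
      intro k j
      by_cases hk : k < K
      · exact congrFun hy (⟨k, hk⟩, j)
      · refine Finset.sum_eq_zero fun t _ => if_neg fun hle => hk ?_
        rw [hK, ← Nat.succ_le_iff, Nat.le_div_iff_mul_le (by omega)]
        have := t.2
        exact hle.trans (by omega)
    have h := sum_sq_transpose_mulVec_le hu (D.U *ᵥ ext0 y) (N := 2 * n) (by omega) hconstr
    rw [D.sum_sq_transpose_mulVec_U, D.sum_sq_U_mulVec, Finset.mul_sum] at h
    have hzero : ∀ i, i ∉ I → ext0 y i = 0 := fun i hi => dif_neg hi
    have hterm : ∀ i, ((2 * n : ℕ) * r) ^ 2 * ext0 y i ^ 2 ≤ (D.γ i * ext0 y i) ^ 2 := by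
      intro i
      by_cases hi : i ∈ I
      · rw [mul_pow (D.γ i)]
        exact mul_le_mul_of_nonneg_right (Finset.mem_filter.1 hi).2.le (sq_nonneg _)
      · simp [hzero i hi]
    -- The two opposite bounds force equality term by term; the strict inequality defining `I` then
    -- kills each coordinate of y.
    have heq := (Finset.sum_eq_sum_iff_of_le fun i _ => hterm i).1
      (le_antisymm (Finset.sum_le_sum fun i _ => hterm i) h)
    ext ⟨i, hi⟩
    have h1 := heq i (Finset.mem_univ i)
    have h2 : ext0 y i = y ⟨i, hi⟩ := dif_pos hi
    rw [h2, mul_pow (D.γ i)] at h1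
    have h3 := (Finset.mem_filter.1 hi).2
    have h4 : (D.γ i ^ 2 - ((2 * n : ℕ) * r) ^ 2) * y ⟨i, hi⟩ ^ 2 = 0 := by linarith
    rcases mul_eq_zero.1 h4 with h5 | h5
    · linarith
    · simpa using h5
  have hcard := LinearMap.finrank_le_finrank_of_injective hinj
  simp only [Module.finrank_fintype_fun_eq_card, Fintype.card_coe, Fintype.card_prod,
    Fintype.card_fin] at hcard
  have hdiv := Nat.div_mul_le_self (T - 1) (2 * n)
  rw [← hK, mul_left_comm] at hdiv
  omega

/-- At least T/2 of the terms γ_i⁻² are each at least 1/(4n²r²). -/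
lemma le_hsNorm_R_sq (D : SVD (obsOp u * sumOp T n)) (hT : 1 ≤ T) (hn : 1 ≤ n) {r : ℝ}
    (hr : 0 < r) (hu : ∀ t, ‖u t‖ ≤ r) : (T : ℝ) ≤ 8 * n ^ 2 * r ^ 2 * hsNorm D.R ^ 2 := by
  have hcard := two_mul_card_large_γ_le D hT hn hu
  set I := Finset.univ.filter fun i => ((2 * n : ℕ) * r) ^ 2 < D.γ i ^ 2 with hI
  have hcompl : (T : ℝ) ≤ 2 * (Iᶜ.card : ℝ) := by
    have := Finset.card_add_card_compl I
    rw [Fintype.card_fin] at this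
    have : T ≤ 2 * Iᶜ.card := by omega
    exact_mod_cast this
  have hn' : (0 : ℝ) < n := by exact_mod_cast hn
  rw [D.R_eq, D.hsNorm_filteredInverse_sq]
  have hsum : (Iᶜ.card : ℝ) * ((4 * n ^ 2 * r ^ 2)⁻¹) ≤ ∑ i, (1 * (D.γ i)⁻¹) ^ 2 := by
    calc _ = ∑ i ∈ Iᶜ, (4 * n ^ 2 * r ^ 2 : ℝ)⁻¹ := by rw [Finset.sum_const, nsmul_eq_mul]
      _ ≤ ∑ i ∈ Iᶜ, (1 * (D.γ i)⁻¹) ^ 2 := by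
          refine Finset.sum_le_sum fun i hi => ?_
          have hi' : D.γ i ^ 2 ≤ ((2 * n : ℕ) * r) ^ 2 := by
            by_contra hlt
            exact Finset.mem_compl.1 hi (Finset.mem_filter.2 ⟨Finset.mem_univ _, not_le.1 hlt⟩)
          rw [one_mul, inv_pow]
          refine inv_anti₀ (pow_pos (D.γ_pos i) 2) (hi'.trans (le_of_eq ?_))
          push_cast
          ring
      _ ≤ _ := Finset.sum_le_univ_sum_of_nonneg fun i => sq_nonneg _
  calc (T : ℝ) ≤ 2 * (Iᶜ.card : ℝ) := hcompl
    _ = 8 * n ^ 2 * r ^ 2 * ((Iᶜ.card : ℝ) * ((4 * n ^ 2 * r ^ 2)⁻¹)) := by field_simp; ring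
    _ ≤ _ := by gcongr

end Spectrum

/-! ### Comparison of the two normalized Hilbert–Schmidt norms. -/

section Averages

lemma card_filter_rev_lt {T p : ℕ} (hp : p ≤ T) :
    (Finset.univ.filter fun i : Fin T => (Fin.rev i : ℕ) < p).card = p := by
  rw [Finset.card_equiv (t := Finset.univ.filter fun i : Fin T => (i : ℕ) < p) Fin.revPerm (by simp),
    Fin.card_filter_val_lt, min_eq_right hp]

/-- The average of the squared singular values of the inverse over the largest `p` of them is at
least the average over all. -/
lemma SVD.mul_hsNorm_R_sq_le {T p : ℕ} {m : Type*} [Fintype m] {A : Matrix (Fin T) m ℝ} (D : SVD A)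
    (hp : p ≤ T) : p * hsNorm D.R ^ 2 ≤ T * hsNorm (D.R' p) ^ 2 := by
  set P := Finset.univ.filter fun i : Fin T => (Fin.rev i : ℕ) < p with hP
  set f : Fin T → ℝ := fun i => ((D.γ i)⁻¹) ^ 2 with hf
  have h1 : hsNorm D.R ^ 2 = ∑ i, f i := by
    rw [D.R_eq, D.hsNorm_filteredInverse_sq]; simp [hf]
  have h2 : hsNorm (D.R' p) ^ 2 = ∑ i ∈ P, f i := by
    rw [D.R'_eq, D.hsNorm_filteredInverse_sq, hP, Finset.sum_filter]
    exact Finset.sum_congr rfl fun i _ => by split_ifs <;> simp [hf]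
  have hcard : P.card = p := card_filter_rev_lt hp
  have hcard' : (Pᶜ.card : ℝ) = T - p := by
    rw [Finset.card_compl, hcard, Fintype.card_fin, Nat.cast_sub hp]
  -- Every retained γ_i⁻² dominates every discarded one; summing over all such pairs compares the
  -- averages.
  have hcross : ∑ i ∈ P, ∑ j ∈ Pᶜ, f j ≤ ∑ i ∈ P, ∑ j ∈ Pᶜ, f i := by
    refine Finset.sum_le_sum fun i hi => Finset.sum_le_sum fun j hj => ?_
    have hi' : (Fin.rev i : ℕ) < p := (Finset.mem_filter.1 hi).2
    have hj' : ¬ (Fin.rev j : ℕ) < p := fun h =>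
      Finset.mem_compl.1 hj (Finset.mem_filter.2 ⟨Finset.mem_univ _, h⟩)
    have hji : j ≤ i := by
      rw [← Fin.rev_le_rev]
      exact Fin.le_def.2 (by omega)
    have := D.γ_antitone hji
    have hγ := D.γ_pos i
    exact pow_le_pow_left₀ (inv_pos.2 (D.γ_pos j)).le (inv_anti₀ hγ this) 2
  simp only [Finset.sum_const, nsmul_eq_mul, ← Finset.mul_sum] at hcross
  rw [hcard, hcard'] at hcross
  rw [h1, h2, ← Finset.sum_add_sum_compl P f]
  linarith

end Averages

/-! ### Concentration of the filtered energies. -/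

section Concentration

variable {Ω : Type*} [MeasurableSpace Ω] {μ : Measure Ω} [IsProbabilityMeasure μ]

lemma IsSG.lintegral_exp_sq_le {X : Ω → ℝ} {κ : ℝ} (h : IsSG μ X κ) (hκ : 0 < κ) :
    ∫⁻ ω, ENNReal.ofReal (Real.exp ((κ ^ 2)⁻¹ / 2 * X ω ^ 2)) ∂μ ≤ 3 := by
  refine lintegral_exp_sq_le_of_tail (by positivity) h.measurable fun t ht => ?_
  have := h.tail t ht
  rwa [div_eq_inv_mul] at this

/-- Hanson–Wright for BᵀB in the joined vector (h, z), with a = κ⁻². Orthogonality of the rows of B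
bounds the Hilbert–Schmidt norm, and their block lengths give the mean. -/
lemma measure_filteredInverse_le {T : ℕ} {m : Type*} [Fintype m] [DecidableEq m]
    {A : Matrix (Fin T) m ℝ} (D : SVD A) (hT : 1 ≤ T) {G : ℝ} (hG : ∀ i, ((D.γ i)⁻¹) ^ 2 ≤ G)
    (q : Fin T → ℝ) (hq : ∀ i, q i ^ 2 ≤ 1)
    {σ η κ : ℝ} (hκ : 0 < κ) {h : Ω → m → ℝ} {z : Ω → Fin T → ℝ}
    (hh : IsISG μ h σ κ) (hz : IsISG μ z η κ) (hhz : IndepFun h z μ) (L : ℝ) :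
    μ.real {ω | 100 * (√T * (1 + G)) * κ ^ 2 * L <
      |euclNorm (D.filteredInverse q *ᵥ (A *ᵥ h ω + z ω)) ^ 2 -
        (σ ^ 2 * ∑ i, q i ^ 2 + η ^ 2 * hsNorm (D.filteredInverse q) ^ 2)|} ≤
      6 * Real.exp (-L) := by
  set ξ : m ⊕ Fin T → Ω → ℝ := Sum.elim (fun i ω => h ω i) (fun i ω => z ω i) with hξ
  set v : m ⊕ Fin T → ℝ := Sum.elim (fun _ => σ ^ 2) (fun _ => η ^ 2) with hv
  set B := D.noiseRow q with hB
  have hTpos : (0 : ℝ) < T := by exact_mod_cast hT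
  have hG0 : 0 ≤ G := (sq_nonneg _).trans (hG ⟨0, hT⟩)
  have hsg : ∀ k, IsSG μ (ξ k) κ := by
    rintro (i | i)
    · exact hh.subGaussian i
    · exact hz.subGaussian i
  have hind : iIndepFun ξ μ := iIndepFun_sumElim hh.indep hz.indep hhz
  have hvar : ∀ k, ∫ ω, ξ k ω ^ 2 ∂μ = v k := by
    rintro (i | i)
    · exact hh.sq_mean i
    · exact hz.sq_mean i
  have hM : ∑ k, ∑ l, (∑ i, B i k * B i l) ^ 2 ≤ (√T * (1 + G)) ^ 2 := by
    -- BᵀB and BBᵀ have equal Hilbert–Schmidt norms, and BBᵀ is diagonal.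
    have hgram : ∑ k, ∑ l, (∑ i, B i k * B i l) ^ 2 = ∑ i, ∑ j, (∑ k, B i k * B j k) ^ 2 := by
      have e1 : ∀ k l, (∑ i, B i k * B i l) ^ 2 = ∑ i, ∑ j, B i k * B j k * (B i l * B j l) := by
        intro k l
        rw [pow_two, Finset.sum_mul_sum]
        exact Finset.sum_congr rfl fun i _ => Finset.sum_congr rfl fun j _ => by ring
      have e2 : ∀ i j, (∑ k, B i k * B j k) ^ 2 = ∑ k, ∑ l, B i k * B j k * (B i l * B j l) := by
        intro i j
        rw [pow_two, Finset.sum_mul_sum]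
      simp_rw [e1, e2]
      calc _ = ∑ k, ∑ i, ∑ l, ∑ j, B i k * B j k * (B i l * B j l) :=
            Finset.sum_congr rfl fun k _ => Finset.sum_comm
        _ = ∑ i, ∑ k, ∑ l, ∑ j, B i k * B j k * (B i l * B j l) := Finset.sum_comm
        _ = ∑ i, ∑ k, ∑ j, ∑ l, B i k * B j k * (B i l * B j l) :=
            Finset.sum_congr rfl fun i _ => Finset.sum_congr rfl fun k _ => Finset.sum_comm
        _ = _ := Finset.sum_congr rfl fun i _ => Finset.sum_comm
    rw [hgram]
    calc _ = ∑ i, (q i ^ 2 * (1 + ((D.γ i)⁻¹) ^ 2)) ^ 2 := by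
          refine Finset.sum_congr rfl fun i _ => ?_
          simp_rw [hB, D.sum_noiseRow_mul]
          simp
      _ ≤ ∑ _i : Fin T, (1 * (1 + G)) ^ 2 := by
          gcongr with i _
          · exact hq i
          · exact hG i
      _ = _ := by
          rw [mul_pow (√_), Real.sq_sqrt hTpos.le]
          simp
  have key := measure_quadraticForm_le (a := (κ ^ 2)⁻¹) (by positivity) hind
    (fun k => (hsg k).measurable) (fun k => (hsg k).mean_zero) hvar
    (fun k => (hsg k).lintegral_exp_sq_le hκ) (fun k l => ∑ i, B i k * B i l)
    (F := √T * (1 + G)) (by positivity) hM L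
  have hquad : ∀ ω, ∑ k, ∑ l, (∑ i, B i k * B i l) * ξ k ω * ξ l ω =
      euclNorm (D.filteredInverse q *ᵥ (A *ᵥ h ω + z ω)) ^ 2 := by
    intro ω
    have hξω : ∀ k, Sum.elim (h ω) (z ω) k = ξ k ω := by rintro (i | i) <;> rfl
    rw [D.euclNorm_filteredInverse_mulVec_sq]
    simp_rw [hξω, pow_two, Finset.sum_mul_sum, Finset.sum_mul]
    calc _ = ∑ k, ∑ i, ∑ l, B i k * B i l * ξ k ω * ξ l ω :=
          Finset.sum_congr rfl fun k _ => Finset.sum_comm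
      _ = ∑ i, ∑ k, ∑ l, B i k * B i l * ξ k ω * ξ l ω := Finset.sum_comm
      _ = _ := Finset.sum_congr rfl fun i _ => Finset.sum_congr rfl fun k _ =>
          Finset.sum_congr rfl fun l _ => by rw [hB]; ring
  have htrace : ∑ k, (∑ i, B i k * B i k) * v k =
      σ ^ 2 * ∑ i, q i ^ 2 + η ^ 2 * hsNorm (D.filteredInverse q) ^ 2 := by
    rw [D.hsNorm_filteredInverse_sq, Fintype.sum_sum_type]
    simp only [hv, Sum.elim_inl, Sum.elim_inr, hB, SVD.noiseRow]
    rw [← Finset.sum_mul, ← Finset.sum_mul]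
    have h1 : ∀ i, ∑ b, q i * D.W i b * (q i * D.W i b) = q i ^ 2 := by
      intro i
      have := D.sum_W_mul_W i i
      rw [if_pos rfl] at this
      calc _ = q i ^ 2 * ∑ b, D.W i b * D.W i b := by
            rw [Finset.mul_sum]; exact Finset.sum_congr rfl fun _ _ => by ring
        _ = _ := by rw [this, mul_one]
    have h2 : ∀ i, ∑ t, q i * (D.γ i)⁻¹ * D.U t i * (q i * (D.γ i)⁻¹ * D.U t i) =
        (q i * (D.γ i)⁻¹) ^ 2 := by
      intro i
      have := D.sum_U_mul_U i i
      rw [if_pos rfl] at this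
      calc _ = (q i * (D.γ i)⁻¹) ^ 2 * ∑ t, D.U t i * D.U t i := by
            rw [Finset.mul_sum]; exact Finset.sum_congr rfl fun _ _ => by ring
        _ = _ := by rw [this, mul_one]
    have s1 : ∑ b, ∑ i, q i * D.W i b * (q i * D.W i b) = ∑ i, q i ^ 2 := by
      rw [Finset.sum_comm]
      exact Finset.sum_congr rfl fun i _ => h1 i
    have s2 : ∑ t, ∑ i, q i * (D.γ i)⁻¹ * D.U t i * (q i * (D.γ i)⁻¹ * D.U t i) =
        ∑ i, (q i * (D.γ i)⁻¹) ^ 2 := by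
      rw [Finset.sum_comm]
      exact Finset.sum_congr rfl fun i _ => h2 i
    rw [s1, s2]
    ring
  simp_rw [hquad, htrace, div_inv_eq_mul] at key
  exact key

end Concentration

/-- Error propagation from the two normalized energies to the two estimators. -/
lemma abs_estimator_sub_le {r r' e e' σ2 η2 ε : ℝ} (hr : 0 < r) (hr' : r < r')
    (he : |e - (σ2 + η2 * r)| ≤ ε) (he' : |e' - (σ2 + η2 * r')| ≤ ε) :
    |e - r * ((e' - e) / (r' - r)) - σ2| ≤ 3 * ε * (1 - r / r')⁻¹ ∧
      |(e' - e) / (r' - r) - η2| ≤ 2 * ε * (1 - r / r')⁻¹ * r⁻¹ := by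
  have hr'0 : 0 < r' := hr.trans hr'
  have hd : 0 < r' - r := sub_pos.2 hr'
  have hε : 0 ≤ ε := (abs_nonneg _).trans he
  have hρ : (1 - r / r')⁻¹ = r' / (r' - r) := by
    rw [← inv_div]; field_simp
  have hη : (e' - e) / (r' - r) - η2 =
      ((e' - (σ2 + η2 * r')) - (e - (σ2 + η2 * r))) / (r' - r) := by
    field_simp; ring
  have hηle : |(e' - e) / (r' - r) - η2| ≤ 2 * ε / (r' - r) := by
    rw [hη, abs_div, abs_of_pos hd]
    gcongr
    exact (abs_sub _ _).trans (by linarith)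
  have hσ : e - r * ((e' - e) / (r' - r)) - σ2 =
      (e - (σ2 + η2 * r)) - r * ((e' - e) / (r' - r) - η2) := by ring
  rw [hρ]
  constructor
  · rw [hσ]
    calc _ ≤ |e - (σ2 + η2 * r)| + |r * ((e' - e) / (r' - r) - η2)| := abs_sub _ _
      _ ≤ ε + r * (2 * ε / (r' - r)) := by
          rw [abs_mul, abs_of_pos hr]
          gcongr
      _ = ε * ((r' + r) / (r' - r)) := by field_simp; ring
      _ ≤ ε * (3 * r' / (r' - r)) := by gcongr; linarith
      _ = _ := by ring
  · refine hηle.trans ?_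
    calc 2 * ε / (r' - r) = 2 * ε * 1 / (r' - r) := by ring
      -- Replacing 1/r' by the larger 1/r means that only `r` needs a lower bound.
      _ ≤ 2 * ε * (r' / r) / (r' - r) := by
          gcongr
          exact (one_le_div hr).2 hr'.le
      _ = _ := by ring

end STVE

/-! ### Assembly of the two error bounds. -/

theorem corollary1 :
    ∃ c : ℝ, 0 < c ∧
      ∀ (T n p : ℕ), 1 ≤ T → (T : ℝ) / 4 ≤ p → p ≤ T →
      ∀ (u : Fin T → EuclideanSpace ℝ (Fin n)), (∀ t, u t ≠ 0) →
      ∀ (D : STVE.SVD (STVE.obsOp u * STVE.sumOp T n)),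
        STVE.hsNorm (D.R' p) ^ 2 / p ≠ STVE.hsNorm D.R ^ 2 / T →
      ∀ (σ η κ : ℝ), 0 < κ →
      ∀ (Ω : Type*) [MeasurableSpace Ω] (μ : Measure Ω) [IsProbabilityMeasure μ]
        (h : Ω → Fin T × Fin n → ℝ) (z : Ω → Fin T → ℝ) (Y : Ω → Fin T → ℝ),
        STVE.IsISG μ h σ κ → STVE.IsISG μ z η κ → IndepFun h z μ →
        (∀ ω, Y ω = (STVE.obsOp u * STVE.sumOp T n) *ᵥ h ω + z ω) →
      ∀ δ : ℝ, 0 < δ → δ < 1 →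
        1 - 8 * δ ≤ μ.real {ω |
          |D.sigmaSqHat p (Y ω) - σ ^ 2| ≤
            c * ((1 + κ ^ 2) * (1 + ((⨅ t, ‖u t‖) ^ 2)⁻¹) * Real.log (1 / δ) / √(T : ℝ)) *
              (1 - p * STVE.hsNorm D.R ^ 2 / (T * STVE.hsNorm (D.R' p) ^ 2))⁻¹ ∧
          |D.etaSqHat p (Y ω) - η ^ 2| ≤
            c * ((1 + κ ^ 2) * (1 + ((⨅ t, ‖u t‖) ^ 2)⁻¹) * Real.log (1 / δ) / √(T : ℝ)) *
              (1 - p * STVE.hsNorm D.R ^ 2 / (T * STVE.hsNorm (D.R' p) ^ 2))⁻¹ *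
              ((n : ℝ) ^ 2 * (⨆ t, ‖u t‖) ^ 2 * Real.log T ^ 2)} := by
  -- The η² bound needs 2·3200·8/(2/5) = 128000, the σ² bound 3·3200 = 9600.
  refine ⟨200000, by norm_num, ?_⟩
  intro T n p hT hTp hpT u hu D hne σ η κ hκ Ω _ μ _ h z Y hh hz hhz hY δ hδ hδ1
  -- For δ ≥ 1/8 the claimed probability is at most 0.
  rcases le_or_gt (1 / 8) δ with hδ8 | hδ8
  · exact le_trans (by linarith) measureReal_nonneg
  have hTpos : (0 : ℝ) < T := by exact_mod_cast hT
  have hppos : (0 : ℝ) < p := lt_of_lt_of_le (by positivity) hTp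
  have : Nonempty (Fin T) := ⟨⟨0, hT⟩⟩
  have hn : 1 ≤ n := by
    by_contra hn
    obtain rfl : n = 0 := by omega
    exact hu ⟨0, hT⟩ (Subsingleton.elim _ _)
  -- T = 1 forces p = 1 and R' = R, contrary to the nondegeneracy assumption. This matters because
  -- log T would vanish.
  have hT2 : 2 ≤ T := by
    by_contra hT2
    obtain rfl : T = 1 := by omega
    obtain rfl : p = 1 := by
      have : 0 < p := by exact_mod_cast hppos
      omega
    refine hne ?_
    rw [D.R_eq, D.R'_eq]
    congr 4
    ext i
    simp
  set umin := ⨅ t, ‖u t‖ with humin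
  set umax := ⨆ t, ‖u t‖ with humax
  have humin_le : ∀ t, umin ≤ ‖u t‖ := fun t => ciInf_le (Set.finite_range _).bddBelow t
  have hle_umax : ∀ t, ‖u t‖ ≤ umax := fun t => le_ciSup (f := fun t => ‖u t‖)
    (Set.finite_range _).bddAbove t
  have humin_pos : 0 < umin := by
    obtain ⟨t, ht⟩ := exists_eq_ciInf_of_finite (f := fun t => ‖u t‖)
    rw [humin, ← ht]
    exact norm_pos_iff.2 (hu t)
  have humax_pos : 0 < umax := humin_pos.trans_le ((humin_le ⟨0, hT⟩).trans (hle_umax _))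
  have hnpos : (0 : ℝ) < n := by exact_mod_cast hn
  set ℓ := Real.log (1 / δ) with hℓ
  have hℓ0 : 0 < ℓ := Real.log_pos (by rw [lt_div_iff₀ hδ]; linarith)
  -- The logarithm is not produced by the estimates; it only has to be bounded below by a constant.
  have hlogT : 2 / 5 ≤ Real.log T ^ 2 := by
    have h1 := Real.log_two_gt_d9
    have h2 : Real.log 2 ≤ Real.log T := Real.log_le_log (by norm_num) (by exact_mod_cast hT2)
    nlinarith
  set r := STVE.hsNorm D.R ^ 2 / T with hr
  set r' := STVE.hsNorm (D.R' p) ^ 2 / p with hr'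
  have hRle := STVE.le_hsNorm_R_sq D hT hn humax_pos hle_umax
  have hR0 : 0 < STVE.hsNorm D.R ^ 2 := by
    by_contra hneg
    have h0 : STVE.hsNorm D.R ^ 2 = 0 := le_antisymm (not_lt.1 hneg) (sq_nonneg _)
    rw [h0, mul_zero] at hRle
    linarith
  have hr0 : 0 < r := by positivity
  have hrr' : r < r' := by
    refine lt_of_le_of_ne ?_ hne.symm
    rw [hr, hr', div_le_div_iff₀ hTpos hppos]
    have := D.mul_hsNorm_R_sq_le hpT
    linarith
  have hratio : p * STVE.hsNorm D.R ^ 2 / (T * STVE.hsNorm (D.R' p) ^ 2) = r / r' := by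
    rw [hr, hr', div_div_div_eq, mul_comm (p : ℝ)]
  have hrinv : r⁻¹ ≤ 8 * n ^ 2 * umax ^ 2 := by
    rw [hr, inv_div, div_le_iff₀ hR0]
    exact hRle
  have hρ : 0 < (1 - r / r')⁻¹ := by
    rw [inv_pos, sub_pos, div_lt_one (hr0.trans hrr')]
    exact hrr'
  set G := 4 * (umin ^ 2)⁻¹ with hG
  have hγG := fun i => STVE.inv_γ_sq_le D humin_pos humin_le i
  set t := 100 * (√T * (1 + G)) * κ ^ 2 * (2 * ℓ) with ht
  set q : Fin T → ℝ := fun i => if (Fin.rev i : ℕ) < p then 1 else 0 with hq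
  have hexp : Real.exp (-(2 * ℓ)) = δ ^ 2 := by
    rw [hℓ, one_div, Real.log_inv, mul_neg, neg_neg, two_mul, Real.exp_add, Real.exp_log hδ, pow_two]
  have hqsum : ∑ i, q i ^ 2 = p := by
    have : ∀ i, q i ^ 2 = if (Fin.rev i : ℕ) < p then 1 else 0 := fun i => by
      simp only [hq]; split_ifs <;> simp
    simp_rw [this]
    rw [Finset.sum_boole, STVE.card_filter_rev_lt hpT]
  have bad := STVE.measure_filteredInverse_le D hT hγG (fun _ => 1) (fun _ => by norm_num) hκ
    hh hz hhz (2 * ℓ)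
  have bad' := STVE.measure_filteredInverse_le D hT hγG q
    (fun i => by simp only [hq]; split_ifs <;> norm_num) hκ hh hz hhz (2 * ℓ)
  simp_rw [← hY, ← D.R_eq] at bad
  simp_rw [← hY, hqsum, hq, ← D.R'_eq] at bad'
  rw [hexp, ← ht] at bad bad'
  -- The 4 comes from p ≥ T/4, so that t/p ≤ ε as well as t/T ≤ ε.
  set ε := 4 * t / T with hε
  have ht0 : 0 ≤ t := by positivity
  have hεle : ε ≤ 3200 * ((1 + κ ^ 2) * (1 + (umin ^ 2)⁻¹) * ℓ / √(T : ℝ)) := by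
    have hs : √(T : ℝ) / T = 1 / √(T : ℝ) := by
      rw [Real.sqrt_div_self']
    have hui : 0 ≤ (umin ^ 2)⁻¹ := by positivity
    calc ε = 800 * (κ ^ 2 * (1 + G) * ℓ * (√(T : ℝ) / T)) := by rw [hε, ht]; ring
      _ ≤ 800 * ((1 + κ ^ 2) * (4 * (1 + (umin ^ 2)⁻¹)) * ℓ * (√(T : ℝ) / T)) := by
          gcongr
          · linarith
          · rw [hG]; linarith
      _ = _ := by rw [hs]; ring
  set X := (1 + κ ^ 2) * (1 + (umin ^ 2)⁻¹) * ℓ / √(T : ℝ) with hX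
  have hX0 : 0 ≤ X := by positivity
  set bad1 := {ω | t < |STVE.euclNorm (D.R *ᵥ Y ω) ^ 2 -
    (σ ^ 2 * ∑ i : Fin T, (1 : ℝ) ^ 2 + η ^ 2 * STVE.hsNorm D.R ^ 2)|} with hbad1
  set bad2 := {ω | t < |STVE.euclNorm (D.R' p *ᵥ Y ω) ^ 2 -
    (σ ^ 2 * p + η ^ 2 * STVE.hsNorm (D.R' p) ^ 2)|} with hbad2
  rw [hratio]
  set good := {ω | |D.sigmaSqHat p (Y ω) - σ ^ 2| ≤ 200000 * X * (1 - r / r')⁻¹ ∧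
    |D.etaSqHat p (Y ω) - η ^ 2| ≤ 200000 * X * (1 - r / r')⁻¹ *
      ((n : ℝ) ^ 2 * umax ^ 2 * Real.log T ^ 2)} with hgood
  have hcover : (Set.univ : Set Ω) ⊆ good ∪ (bad1 ∪ bad2) := by
    intro ω _
    by_cases h1 : ω ∈ bad1
    · exact Or.inr (Or.inl h1)
    by_cases h2 : ω ∈ bad2
    · exact Or.inr (Or.inr h2)
    left
    have h1' : |STVE.euclNorm (D.R *ᵥ Y ω) ^ 2 -
      (σ ^ 2 * ∑ i : Fin T, (1 : ℝ) ^ 2 + η ^ 2 * STVE.hsNorm D.R ^ 2)| ≤ t := not_lt.1 h1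
    have h2' : |STVE.euclNorm (D.R' p *ᵥ Y ω) ^ 2 -
      (σ ^ 2 * p + η ^ 2 * STVE.hsNorm (D.R' p) ^ 2)| ≤ t := not_lt.1 h2
    have he : |STVE.euclNorm (D.R *ᵥ Y ω) ^ 2 / T - (σ ^ 2 + η ^ 2 * r)| ≤ ε := by
      have : STVE.euclNorm (D.R *ᵥ Y ω) ^ 2 / T - (σ ^ 2 + η ^ 2 * r) =
          (STVE.euclNorm (D.R *ᵥ Y ω) ^ 2 -
            (σ ^ 2 * ∑ i : Fin T, (1 : ℝ) ^ 2 + η ^ 2 * STVE.hsNorm D.R ^ 2)) / T := by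
        rw [hr]
        simp only [one_pow, Finset.sum_const, Finset.card_univ, Fintype.card_fin, nsmul_eq_mul]
        field_simp
      rw [this, abs_div, abs_of_pos hTpos, hε]
      gcongr
      linarith
    have he' : |STVE.euclNorm (D.R' p *ᵥ Y ω) ^ 2 / p - (σ ^ 2 + η ^ 2 * r')| ≤ ε := by
      have : STVE.euclNorm (D.R' p *ᵥ Y ω) ^ 2 / p - (σ ^ 2 + η ^ 2 * r') =
          (STVE.euclNorm (D.R' p *ᵥ Y ω) ^ 2 -
            (σ ^ 2 * p + η ^ 2 * STVE.hsNorm (D.R' p) ^ 2)) / p := by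
        rw [hr']
        field_simp
      rw [this, abs_div, abs_of_pos hppos, hε]
      calc _ ≤ t / p := by gcongr
        _ ≤ t / (T / 4) := by gcongr
        _ = _ := by field_simp
    obtain ⟨hσ, hη⟩ := STVE.abs_estimator_sub_le hr0 hrr' he he'
    refine ⟨hσ.trans ?_, hη.trans ?_⟩
    · exact mul_le_mul_of_nonneg_right (by linarith) hρ.le
    · calc 2 * ε * (1 - r / r')⁻¹ * r⁻¹
          ≤ 2 * (3200 * X) * (1 - r / r')⁻¹ * (8 * n ^ 2 * umax ^ 2) := by gcongr
        _ = 128000 * X * (1 - r / r')⁻¹ * (n ^ 2 * umax ^ 2 * (2 / 5)) := by ring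
        _ ≤ _ := by gcongr; norm_num
  have hone : (1 : ℝ) ≤ μ.real good + (μ.real bad1 + μ.real bad2) := by
    calc (1 : ℝ) = μ.real Set.univ := by simp
      _ ≤ _ := measureReal_mono hcover
      _ ≤ _ := measureReal_union_le _ _
      _ ≤ _ := by gcongr; exact measureReal_union_le _ _
  -- Taking L = 2 log(1/δ) makes each bad event cost 6δ²; for δ < 1/8 the total 12δ² is below 8δ.
  have hδsq : δ ^ 2 ≤ δ / 8 := by nlinarith
  linarith
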